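/- **Theorem (robust dual adversary algorithm).** Let $n,m\ge 1$ and $\mathcal H=\mathbb C\oplus(\mathbb C^n\otimes\mathbb C^m\otimes\mathbb C^2)$, with $|\hat 0\rangle$ the unit vector of the first summand. For $x\in\{0,1\}^n$ let $\Pi_x=|\hat0\rangle\langle\hat0|+\sum_{i=1}^n|i\rangle\langle i|\otimes I\otimes|x_i\rangle\langle x_i|$, let $R$ be an arbitrary unitary on $\mathcal H$ that does not depend on $x$ (not necessarily a reflection), and let $U_x=(2\Pi_x-I)R$; the base-2 logarithm of $\dim\mathcal H$ is $O(\log(nm+1))$. Let $0<\theta\le1$ and $0<\delta\le1$. *Phase estimation.* For $t,K\in\mathbb N$, run $K$ parallel copies of $t$-bit phase estimation on a unitary $U$ with initial state $|\hat0\rangle$ (uniform superposition in $K$ registers of $t$ qubits, $U^{j_1+\dots+j_K}$ controlled on the register contents $j_1,\dots,j_K$, inverse Fourier transform modulo $2^t$ on each register, measurement of the registers), giving $y_1,\dots,y_K$ and the phase estimates $2\pi y_k/2^t$. The outcome is "phase $0$" if more than half of the estimates are at distance at most $3\theta/4$ from $0$ modulo $2\pi$. Let $p_0(U)$ be the probability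 of this outcome. *Query model.* The oracle acts by $O_x|i\rangle|b\rangle=|i\rangle|b\oplus x_i\rangle$ on $\mathbb C^n\otimes\mathbb C^2$, tensored with the identity on a workspace. A query algorithm with $T$ queries prepares $V_TO_xV_{T-1}O_x\cdots V_1O_xV_0|\mathrm{init}\rangle$ with unitaries $V_k$ and an initial basis state independent of $x$ and makes a two-outcome measurement; its number of qubits is $\log_2$ of the dimension of its Hilbert space. *Claim.* For all $\theta,\delta$ as above there are $t,K$, depending only on $\theta$ and $\delta$ (phase estimation with precision $\theta$ and error $\delta$), such that for all $n,m,R$ the following hold. (a) There is a query algorithm that uses $O\!\left(\frac1\theta\log\frac1\delta\right)$ queries and $O\!\left(\log(nm+1)+\log\frac2\theta\,\log\frac1\delta\right)$ qubits, and whose acceptance probability is $p_0(U_x)$ on every input $x\in\{0,1\}^n$. The constants in the $O$'s are absolute. (b) Let $X\subseteq\{0,1\}^n$, $f:X\to\{0,1\}$, $\nu_x,\mu_x>0$ for $x\in X$, and $\varepsilon_\psi,\varepsilon_\phi\ge0$. For each $x\in X$ let $|\eta_x\rangle\in\mathcal H$ with $\langle\eta_x|\hat0\rangle=0$; let $|\psi_x\rangle=\frac1{\sqrt{\nu_x}}(|\hat0\rangle+|\eta_x\rangle)$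 if $f(x)=1$ and $|\phi_x\rangle=\frac1{\sqrt{\mu_x}}(|\hat0\rangle+|\eta_x\rangle)$ if $f(x)=0$ (not necessarily normalized). Suppose that 1. $\|(I-U_x)|\psi_x\rangle\|\le\varepsilon_\psi$ for all $x$ with $f(x)=1$, and 2. $\Pi_x|\eta_x\rangle=0$ and $\|(I+R)|\phi_x\rangle\|\le\varepsilon_\phi$ for all $x$ with $f(x)=0$. Write $a_+=\max(a,0)$. Then for every $x$ with $f(x)=1$ $$p_0(U_x)\ \ge\ \left(\sqrt{\Big(\nu_x\big(\||\psi_x\rangle\|^2-\tfrac{5\varepsilon_\psi^2}{\theta^2}\big)\Big)_+}-\sqrt{\nu_x\||\psi_x\rangle\|^2-1}\right)_+^2(1-\delta)-\delta ,$$ and, if moreover $\||\psi_x\rangle\|\ge1$ (for instance if $|\psi_x\rangle$ is normalized), $$p_0(U_x)\ \ge\ \left(\sqrt{\Big(\nu_x\big(1-\tfrac{5\varepsilon_\psi^2}{\theta^2}\big)\Big)_+}-\sqrt{\nu_x\||\psi_x\rangle\|^2-1}\right)_+^2(1-\delta)-\delta ;$$ and for every $x$ with $f(x)=0$ $$p_0(U_x)\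 \le\ \mu_x\left(\frac{\varepsilon_\phi}2+\frac\theta2\||\phi_x\rangle\|\right)^2+\delta .$$ -/

import Mathlib

noncomputable section

namespace DualAdversary

/-! ### The space `ℂ ⊕ ℂⁿ ⊗ ℂᵐ ⊗ ℂ²`, the projector `Π_x`, and the unitary `U = (2 Π_x - I) R` -/

/-- Labels of the standard basis of `ℂ ⊕ ℂⁿ ⊗ ℂᵐ ⊗ ℂ²`: `Sum.inl ()` labels `|0̂⟩`, and
`Sum.inr (i, k, b)` labels `|i⟩|k⟩|b⟩`. -/
abbrev Idx (n m : ℕ) : Type := Unit ⊕ (Fin n × Fin m × Bool)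

/-- The Hilbert space `ℂ ⊕ ℂⁿ ⊗ ℂᵐ ⊗ ℂ²`. -/
abbrev Space (n m : ℕ) : Type := EuclideanSpace ℂ (Idx n m)

/-- The unit vector `|0̂⟩`. -/
def ket0 (n m : ℕ) : Space n m := EuclideanSpace.single (Sum.inl ()) 1

/-- `Π_x = |0̂⟩⟨0̂| + ∑ i, |i⟩⟨i| ⊗ I ⊗ |x_i⟩⟨x_i|`, which is diagonal in the standard basis. -/
def proj {n m : ℕ} (x : Fin n → Bool) : Space n m →L[ℂ] Space n m :=
  Matrix.toEuclideanCLM (n := Idx n m) (𝕜 := ℂ)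
    (Matrix.diagonal fun p : Idx n m =>
      match p with
      | Sum.inl _ => 1
      | Sum.inr (i, _, b) => if b = x i then 1 else 0)

/-- `U = (2 Π_x - I) R`. -/
def walk {n m : ℕ} (R : Space n m →L[ℂ] Space n m) (x : Fin n → Bool) :
    Space n m →L[ℂ] Space n m :=
  ((2 : ℂ) • proj x - 1) * R

/-! ### Phase estimation: `K` parallel `t`-bit estimates followed by a median vote

The joint state of the system `E` and of `K` registers with `t` qubits each is
`∑ j, s j ⊗ |j₁⟩…|j_K⟩`; it is represented by the function `s`. -/

section PhaseEstimation

variable {E : Type*} [NormedAddCommGroup E] [InnerProductSpace ℂ E]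

/-- The contents of `K` registers of `t` qubits each. -/
abbrev Registers (t K : ℕ) : Type := Fin K → Fin (2 ^ t)

/-- `|ψ⟩` tensored with the uniform superposition in all the registers (Hadamard gates applied to
registers that hold zeros). -/
def uniformRegisters (t K : ℕ) (ψ : E) : Registers t K → E :=
  fun _ => ((∏ _k : Fin K, 1 / Real.sqrt (2 ^ t) : ℝ) : ℂ) • ψ

/-- Controlled powers of `U`: each register `k` that holds `j k` applies `U ^ (j k)`. -/
def controlledPowers (t K : ℕ) (U : E →L[ℂ] E) (s : Registers t K → E) : Registers t K → E :=
  fun j => (U ^ (∑ k, (j k : ℕ))) (s j)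

/-- The inverse quantum Fourier transform modulo `2 ^ t` on each register. -/
def inverseFourier (t K : ℕ) (s : Registers t K → E) : Registers t K → E :=
  fun y => ∑ j : Registers t K,
    (∏ k, (((1 / Real.sqrt (2 ^ t) : ℝ) : ℂ) *
      Complex.exp (-(2 * Real.pi * Complex.I * ((j k : ℕ) : ℂ) * ((y k : ℕ) : ℂ) / 2 ^ t)))) • s j

/-- The final state of phase estimation on `U` with initial state `ψ`. -/
def phaseEstimationState (t K : ℕ) (U : E →L[ℂ] E) (ψ : E) : Registers t K → E :=
  inverseFourier t K (controlledPowers t K U (uniformRegisters t K ψ))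

/-- The absolute value, in `[0, π]`, of the phase `2 π y / 2 ^ t` taken modulo `2 π`. -/
def absPhase (t : ℕ) (y : Fin (2 ^ t)) : ℝ :=
  2 * Real.pi * (min (y : ℕ) (2 ^ t - (y : ℕ)) : ℕ) / 2 ^ t

/-- The estimates `y` give the outcome "phase `0`" at precision `θ`: more than half of them (so
their median in absolute value) are at most `3 θ / 4` away from `0`. The threshold is halfway
between `θ / 2` and `θ`. -/
def IsPhaseZero (t K : ℕ) (θ : ℝ) (y : Registers t K) : Prop :=
  K < 2 * {k : Fin K | absPhase t (y k) ≤ 3 * θ / 4}.ncard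

open Classical in
/-- The probability of the outcome "phase `0`" when the registers are measured at the end of
phase estimation on `U` with initial state `ψ`. -/
def probPhaseZero (t K : ℕ) (θ : ℝ) (U : E →L[ℂ] E) (ψ : E) : ℝ :=
  ∑ y : Registers t K with IsPhaseZero t K θ y, ‖phaseEstimationState t K U ψ y‖ ^ 2

end PhaseEstimation

/-! ### Quantum query algorithms -/

/-- The Hilbert space `ℂⁿ ⊗ ℂ² ⊗ ℂ^W` of a query algorithm with workspace labels `W`. -/
abbrev QuerySpace (n : ℕ) (W : Type) [Fintype W] : Type :=
  EuclideanSpace ℂ (Fin n × Bool × W)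

/-- The permutation `(i, b, w) ↦ (i, b ⊕ x_i, w)` of the basis labels. -/
def oraclePerm {n : ℕ} (W : Type) (x : Fin n → Bool) : Equiv.Perm (Fin n × Bool × W) :=
  Function.Involutive.toPerm (fun p => (p.1, xor p.2.1 (x p.1), p.2.2)) (by
    rintro ⟨i, b, w⟩
    simp)

/-- The oracle `O_x |i⟩|b⟩|w⟩ = |i⟩|b ⊕ x_i⟩|w⟩`. -/
def oracle {n : ℕ} (W : Type) [Fintype W] (x : Fin n → Bool) :
    QuerySpace n W ≃ₗᵢ[ℂ] QuerySpace n W :=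
  LinearIsometryEquiv.piLpCongrLeft 2 ℂ ℂ (oraclePerm W x)

/-- A quantum query algorithm `U_T O_x U_{T-1} O_x ⋯ U_1 O_x U_0 |init⟩`, with unitaries that do
not depend on the input `x`, followed by a two-outcome measurement in the standard basis. -/
structure QueryAlgorithm (n : ℕ) (W : Type) [Fintype W] [DecidableEq W] where
  /-- The number `T` of oracle calls. -/
  queries : ℕ
  /-- The unitaries `U_0, …, U_T` (those with a larger index are not used). -/
  gate : ℕ → (QuerySpace n W ≃ₗᵢ[ℂ] QuerySpace n W)
  /-- The label of the initial basis state. -/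
  init : Fin n × Bool × W
  /-- The labels on which the measurement accepts. -/
  accept : Finset (Fin n × Bool × W)

namespace QueryAlgorithm

variable {n : ℕ} {W : Type} [Fintype W] [DecidableEq W]

/-- The state after `k` oracle calls, `U_k O_x ⋯ U_1 O_x U_0 |init⟩`. -/
def state (A : QueryAlgorithm n W) (x : Fin n → Bool) : ℕ → QuerySpace n W
  | 0 => A.gate 0 (EuclideanSpace.single A.init 1)
  | k + 1 => A.gate (k + 1) (oracle W x (A.state x k))

/-- The probability that the measurement accepts on input `x`. -/
def probAccept (A : QueryAlgorithm n W) (x : Fin n → Bool) : ℝ :=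
  ∑ p ∈ A.accept, ‖A.state x A.queries p‖ ^ 2

/-- The number `log₂ S` of qubits, where `S` is the dimension of the Hilbert space. -/
def qubits (_A : QueryAlgorithm n W) : ℝ :=
  Real.logb 2 (Fintype.card (Fin n × Bool × W))

end QueryAlgorithm

end DualAdversary

end

noncomputable section

namespace DualAdversary

/-! ### Diagonalization of unitary operators -/

section Spectral

variable {E : Type*} [NormedAddCommGroup E] [InnerProductSpace ℂ E] [FiniteDimensional ℂ E]

/-! The unitary `U = walk R x` has an orthonormal eigenbasis with eigenvalues `exp (i ω)`, and phase
estimation acts diagonally in it. Hence the probability of "phase 0" is an average of the numbers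
`eigenProb t K θ ω`, weighted by the squared coordinates of `|0̂⟩` (`probPhaseZero_eq_sum`). A
geometric sum bounds the tail of a single estimate, and a Chernoff bound amplifies it: the weight is
at least `1 - δ` for `|ω| ≤ θ / 2` and at most `δ` for `|ω| ≥ θ`. What remains is to bound the
component of `|0̂⟩` in these two windows of small phases.

Lower bound (`overlap_sq_le_spectralCut`): `‖ψ - Uψ‖ ≤ ε` leaves at most `5ε²/θ²` of `‖ψ‖²` outside
the window `|ω| ≤ θ / 2`. Since `√ν ψ = |0̂⟩ + η` with `η ⊥ |0̂⟩`, one has `‖η‖² = ν‖ψ‖² - 1`, and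
the triangle inequality passes from `ψ` to `|0̂⟩`.

Upper bound (`norm_sq_spectralCut_ket0_le`): `√μ Π_x φ = |0̂⟩`, and `2 Π_x φ = (φ - Uφ) + (2Π_x -
I)(φ + Rφ)`. On the window `|ω| < θ` the first term has norm at most `θ‖φ‖`, the second at most `ε`.
This form of the effective spectral gap lemma needs no two-reflection structure, so any unitary `R`
is allowed.

For the query count, the sign of `2Π_x - I` is `(-1)^b (-1)^(x_i)`, whose second factor is one
oracle call by phase kickback (`oracle_embed`). The power `U ^ (j₁ + ⋯ + j_K)` takes `K (2 ^ t - 1)`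
controlled steps. When `δ ≥ 1 / 2` no register is used, and the bounds hold trivially. -/

theorem isSemisimple_of_linearIsometry (U : E →ₗᵢ[ℂ] E) :
    Module.End.IsSemisimple U.toLinearMap := by
  rw [Module.End.isSemisimple_iff]
  intro p hp
  -- In finite dimension an invariant subspace is mapped onto itself, so its orthogonal complement
  -- is invariant too.
  have hmap : p.map U.toLinearMap = p := by
    apply Submodule.eq_of_le_of_finrank_eq
    · exact Submodule.map_le_iff_le_comap.2 hp
    · exact (LinearEquiv.finrank_eq (p.equivMapOfInjective U.toLinearMap U.injective)).symm
  refine ⟨pᗮ, ?_, Submodule.isCompl_orthogonal _⟩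
  intro v hv
  rw [Submodule.mem_comap, Submodule.mem_orthogonal]
  intro w hw
  rw [← hmap] at hw
  obtain ⟨w', hw', rfl⟩ := hw
  exact (U.inner_map_map w' v).trans ((Submodule.mem_orthogonal p v).1 hv w' hw')

omit [FiniteDimensional ℂ E] in
theorem orthogonalFamily_eigenspaces_of_linearIsometry (U : E →ₗᵢ[ℂ] E) :
    OrthogonalFamily ℂ (fun μ : ℂ => Module.End.eigenspace U.toLinearMap μ)
      fun μ => (Module.End.eigenspace U.toLinearMap μ).subtypeₗᵢ := by
  rintro μ ν hμν ⟨v, hv⟩ ⟨w, hw⟩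
  rw [Module.End.mem_eigenspace_iff] at hv hw
  change inner ℂ v w = 0
  by_cases hv0 : v = 0
  · simp [hv0]
  have hμ : ‖μ‖ = 1 := by
    have h := U.norm_map v
    have h2 : U v = μ • v := hv
    rw [h2, norm_smul] at h
    exact mul_right_cancel₀ (norm_ne_zero_iff.2 hv0) (h.trans (one_mul _).symm)
  have h := U.inner_map_map v w
  have h1 : U v = μ • v := hv
  have h2 : U w = ν • w := hw
  rw [h1, h2, inner_smul_left, inner_smul_right, ← mul_assoc] at h
  by_contra h0
  have h3 : (starRingEnd ℂ) μ * ν = 1 := mul_right_cancel₀ h0 (h.trans (one_mul _).symm)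
  have h4 : (starRingEnd ℂ) μ * μ = 1 := by
    rw [Complex.conj_mul', hμ]; simp
  have h5 : (starRingEnd ℂ) μ ≠ 0 := left_ne_zero_of_mul_eq_one h4
  exact hμν (mul_left_cancel₀ h5 (h4.trans h3.symm))

/-- A unitary operator has an orthonormal basis of eigenvectors, with eigenvalues `exp (i ω)`. -/
theorem exists_orthonormalBasis_exp (U : E →ₗᵢ[ℂ] E) :
    ∃ (b : OrthonormalBasis (Fin (Module.finrank ℂ E)) ℂ E) (ω : Fin (Module.finrank ℂ E) → ℝ),
      (∀ a, |ω a| ≤ Real.pi) ∧ ∀ a, U (b a) = Complex.exp (ω a * Complex.I) • b a := by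
  classical
  -- Over `ℂ` the generalized eigenspaces span; semisimplicity makes them eigenspaces.
  have htop : ⨆ μ : ℂ, Module.End.eigenspace U.toLinearMap μ = ⊤ := by
    rw [← Module.End.iSup_maxGenEigenspace_eq_top U.toLinearMap]
    exact iSup_congr fun μ =>
      ((isSemisimple_of_linearIsometry U).isFinitelySemisimple.maxGenEigenspace_eq_eigenspace μ).symm
  -- Only nonzero eigenspaces serve as summands, so that the index type is finite.
  have hfin : Finite {μ : ℂ // Module.End.eigenspace U.toLinearMap μ ≠ ⊥} :=
    (Module.End.finite_hasEigenvalue U.toLinearMap).subset fun _ hμ => hμ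
  have := Fintype.ofFinite {μ : ℂ // Module.End.eigenspace U.toLinearMap μ ≠ ⊥}
  have hO := (orthogonalFamily_eigenspaces_of_linearIsometry U).comp
    (Subtype.val_injective (p := fun μ : ℂ => Module.End.eigenspace U.toLinearMap μ ≠ ⊥))
  have hI : DirectSum.IsInternal
      (fun μ : {μ : ℂ // Module.End.eigenspace U.toLinearMap μ ≠ ⊥} =>
        Module.End.eigenspace U.toLinearMap μ.1) := by
    rw [hO.isInternal_iff, Submodule.orthogonal_eq_bot_iff]
    rw [← htop]
    exact iSup_ne_bot_subtype _
  let b := hI.subordinateOrthonormalBasis rfl hO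
  let l := fun a => hI.subordinateOrthonormalBasisIndex rfl a hO
  have hb : ∀ a, U (b a) = (l a).1 • b a := fun a =>
    Module.End.mem_eigenspace_iff.1 (hI.subordinateOrthonormalBasis_subordinate rfl a hO)
  refine ⟨b, fun a => Complex.arg (l a).1, fun a => Complex.abs_arg_le_pi _, fun a => ?_⟩
  have hn : ‖(l a).1‖ = 1 := by
    have h := U.norm_map (b a)
    rw [hb, norm_smul, b.norm_eq_one, mul_one] at h
    exact h
  have h := Complex.norm_mul_exp_arg_mul_I (l a).1
  rw [hn, Complex.ofReal_one, one_mul] at h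
  rw [h, hb]

end Spectral

/-! ### One register of phase estimation -/

/-- `∑ 1 / (4 (u - q)²)` over integers `q` at distance at least `D` from `u`. -/
theorem sum_range_tail_le (u D : ℝ) (hD : 1 ≤ D) (M : ℕ) :
    ∑ q ∈ Finset.range M, (if D ≤ |u - q| then 1 / (4 * (u - q) ^ 2) else 0)
      ≤ 1 / (2 * (D - 1 / 2)) := by
  set E := D - 1 / 2 with hE
  have hE0 : 0 < E := by linarith
  -- The sum telescopes against `H`, which is constant on `[-E, E]` and increases from above `-1 /
  -- (4E)` to below `1 / (4E)`. A term with `|u - q| ≥ D` uses an interval of length 1 on one side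
  -- of `(-E, E)`.
  let H : ℝ → ℝ := fun s => (1 / max (-s) E - 1 / max s E) / 4
  have hlo : ∀ s, 0 < 1 / max s E ∧ 1 / max s E ≤ 1 / E := fun s =>
    ⟨by positivity, one_div_le_one_div_of_le hE0 (le_max_right _ _)⟩
  have hmono : Monotone H := by
    intro a b hab
    have h1 : 1 / max (-a) E ≤ 1 / max (-b) E :=
      one_div_le_one_div_of_le (by positivity) (max_le_max (by linarith) le_rfl)
    have h2 : 1 / max b E ≤ 1 / max a E :=
      one_div_le_one_div_of_le (by positivity) (max_le_max (by linarith) le_rfl)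
    simp only [H]
    linarith
  have key : ∀ s : ℝ, 1 ≤ s → 1 / (4 * s ^ 2) ≤ (1 / (s - 1 / 2) - 1 / (s + 1 / 2)) / 4 := by
    intro s hs
    have h1 : 0 < s - 1 / 2 := by linarith
    have h2 : 0 < s + 1 / 2 := by linarith
    have h3 : (1 / (s - 1 / 2) - 1 / (s + 1 / 2)) / 4 = 1 / (4 * ((s - 1 / 2) * (s + 1 / 2))) := by
      rw [div_sub_div _ _ h1.ne' h2.ne', div_div, show 1 * (s + 1 / 2) - (s - 1 / 2) * 1 = 1 by ring,
        mul_comm (4 : ℝ)]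
    rw [h3]
    apply one_div_le_one_div_of_le (by positivity)
    nlinarith
  have hstep : ∀ q : ℕ, (if D ≤ |u - q| then 1 / (4 * (u - q) ^ 2) else 0)
      ≤ H (((q + 1 : ℕ) : ℝ) - u - 1 / 2) - H ((q : ℝ) - u - 1 / 2) := by
    intro q
    split_ifs with h
    · push_cast
      rcases le_abs.1 h with h | h
      · have := key (u - q) (hD.trans h)
        simp only [H]
        rw [max_eq_left (show E ≤ -((q : ℝ) + 1 - u - 1 / 2) by linarith),
          max_eq_right (show (q : ℝ) + 1 - u - 1 / 2 ≤ E by linarith),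
          max_eq_left (show E ≤ -((q : ℝ) - u - 1 / 2) by linarith),
          max_eq_right (show (q : ℝ) - u - 1 / 2 ≤ E by linarith),
          show -((q : ℝ) + 1 - u - 1 / 2) = u - q - 1 / 2 by ring,
          show -((q : ℝ) - u - 1 / 2) = u - q + 1 / 2 by ring]
        linarith
      · have := key (q - u) (by linarith)
        rw [show (u - q) ^ 2 = (q - u) ^ 2 by ring]
        simp only [H]
        rw [max_eq_right (show -((q : ℝ) + 1 - u - 1 / 2) ≤ E by linarith),
          max_eq_left (show E ≤ (q : ℝ) + 1 - u - 1 / 2 by linarith),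
          max_eq_right (show -((q : ℝ) - u - 1 / 2) ≤ E by linarith),
          max_eq_left (show E ≤ (q : ℝ) - u - 1 / 2 by linarith),
          show (q : ℝ) + 1 - u - 1 / 2 = q - u + 1 / 2 by ring]
        linarith
    · exact sub_nonneg.2 (hmono (by push_cast; linarith))
  refine (Finset.sum_le_sum fun q _ => hstep q).trans ?_
  rw [Finset.sum_range_sub (fun q : ℕ => H ((q : ℝ) - u - 1 / 2))]
  have h1 := hlo (-((M : ℝ) - u - 1 / 2))
  have h2 := hlo ((M : ℝ) - u - 1 / 2)
  have h3 := hlo (-(((0 : ℕ) : ℝ) - u - 1 / 2))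
  have h4 := hlo (((0 : ℕ) : ℝ) - u - 1 / 2)
  have h5 : 1 / (2 * E) = 1 / E / 2 := by field_simp
  simp only [H]
  rw [h5]
  linarith

/-- The kernel of the inverse Fourier transform modulo `2 ^ t`. -/
def fourierKernel (t : ℕ) (j y : Fin (2 ^ t)) : ℂ :=
  ((1 / Real.sqrt (2 ^ t) : ℝ) : ℂ) *
    Complex.exp (-(2 * Real.pi * Complex.I * ((j : ℕ) : ℂ) * ((y : ℕ) : ℂ) / 2 ^ t))

theorem one_div_sqrt_mul_self (t : ℕ) :
    ((1 / Real.sqrt (2 ^ t) : ℝ) : ℂ) * ((1 / Real.sqrt (2 ^ t) : ℝ) : ℂ) = 1 / 2 ^ t := by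
  rw [← Complex.ofReal_mul, div_mul_div_comm, Real.mul_self_sqrt (by positivity)]
  push_cast
  ring

theorem sum_conj_fourierKernel_mul (t : ℕ) (j j' : Fin (2 ^ t)) :
    ∑ y, (starRingEnd ℂ) (fourierKernel t j y) * fourierKernel t j' y = if j = j' then 1 else 0 := by
  set ζ := Complex.exp (2 * Real.pi * Complex.I / ((2 ^ t : ℕ) : ℂ)) with hζ
  have hprim : IsPrimitiveRoot ζ (2 ^ t) := Complex.isPrimitiveRoot_exp _ (by positivity)
  have hζ0 : ζ ≠ 0 := Complex.exp_ne_zero _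
  have hterm : ∀ y : Fin (2 ^ t), (starRingEnd ℂ) (fourierKernel t j y) * fourierKernel t j' y
      = 1 / 2 ^ t * (ζ ^ (j : ℕ) / ζ ^ (j' : ℕ)) ^ (y : ℕ) := by
    intro y
    have h1 : (ζ ^ (j : ℕ) / ζ ^ (j' : ℕ)) ^ (y : ℕ)
        = Complex.exp (2 * Real.pi * Complex.I * ((j : ℕ) : ℂ) * ((y : ℕ) : ℂ) / 2 ^ t)
        * Complex.exp (-(2 * Real.pi * Complex.I * ((j' : ℕ) : ℂ) * ((y : ℕ) : ℂ) / 2 ^ t)) := by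
      rw [hζ, ← Complex.exp_nat_mul, ← Complex.exp_nat_mul, ← Complex.exp_sub,
        ← Complex.exp_nat_mul, ← Complex.exp_add]
      congr 1
      push_cast
      ring
    rw [h1, ← one_div_sqrt_mul_self]
    simp only [fourierKernel, map_mul, Complex.conj_ofReal, ← Complex.exp_conj, map_neg, map_div₀,
      Complex.conj_I, map_natCast, map_pow, map_ofNat]
    rw [show -(2 * (Real.pi : ℂ) * -Complex.I * ((j : ℕ) : ℂ) * ((y : ℕ) : ℂ) / 2 ^ t)
      = 2 * (Real.pi : ℂ) * Complex.I * ((j : ℕ) : ℂ) * ((y : ℕ) : ℂ) / 2 ^ t by ring]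
    ring
  simp_rw [hterm]
  rw [← Finset.mul_sum,
    Fin.sum_univ_eq_sum_range (fun y => (ζ ^ (j : ℕ) / ζ ^ (j' : ℕ)) ^ y) (2 ^ t)]
  split_ifs with h
  · subst h
    simp [div_self (pow_ne_zero _ hζ0)]
  · have hne : ζ ^ (j : ℕ) / ζ ^ (j' : ℕ) ≠ 1 := by
      intro h1
      rw [div_eq_one_iff_eq (pow_ne_zero _ hζ0)] at h1
      exact h (Fin.ext (hprim.pow_inj j.2 j'.2 h1))
    rw [geom_sum_eq hne, div_pow, ← pow_mul, ← pow_mul, mul_comm (j : ℕ), mul_comm (j' : ℕ),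
      pow_mul, pow_mul, hprim.pow_eq_one]
    simp

/-- A kernel with orthonormal columns preserves the sum of the squared norms. -/
theorem sum_norm_sq_sum_smul {J Y E : Type*} [Fintype J] [DecidableEq J] [Fintype Y]
    [NormedAddCommGroup E] [InnerProductSpace ℂ E] (c : J → Y → ℂ)
    (hc : ∀ j j', ∑ y, (starRingEnd ℂ) (c j y) * c j' y = if j = j' then 1 else 0) (s : J → E) :
    ∑ y, ‖∑ j, c j y • s j‖ ^ 2 = ∑ j, ‖s j‖ ^ 2 := by
  have h : (∑ y, inner ℂ (∑ j, c j y • s j) (∑ j, c j y • s j)) = ∑ j, inner ℂ (s j) (s j) := by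
    simp_rw [sum_inner, inner_sum, inner_smul_left, inner_smul_right, ← mul_assoc]
    rw [Finset.sum_comm]
    refine Finset.sum_congr rfl fun j _ => ?_
    rw [Finset.sum_comm]
    simp_rw [← Finset.sum_mul, hc]
    simp
  simp_rw [inner_self_eq_norm_sq_to_K] at h
  exact_mod_cast h

/-- The amplitude of the estimate `y` when phase estimation runs on an eigenvalue `exp (i ω)`. -/
def regAmp (t : ℕ) (ω : ℝ) (y : Fin (2 ^ t)) : ℂ :=
  ∑ j : Fin (2 ^ t), fourierKernel t j y *
    (((1 / Real.sqrt (2 ^ t) : ℝ) : ℂ) * Complex.exp (ω * Complex.I) ^ (j : ℕ))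

theorem sum_norm_sq_regAmp (t : ℕ) (ω : ℝ) : ∑ y, ‖regAmp t ω y‖ ^ 2 = 1 := by
  have h := sum_norm_sq_sum_smul (fourierKernel t) (sum_conj_fourierKernel_mul t)
    (fun j => ((1 / Real.sqrt (2 ^ t) : ℝ) : ℂ) * Complex.exp (ω * Complex.I) ^ (j : ℕ))
  simp only [smul_eq_mul] at h
  unfold regAmp
  rw [h]
  simp

theorem absPhase_nonneg (t : ℕ) (y : Fin (2 ^ t)) : 0 ≤ absPhase t y := by
  unfold absPhase; positivity

theorem absPhase_le_pi (t : ℕ) (y : Fin (2 ^ t)) : absPhase t y ≤ Real.pi := by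
  unfold absPhase
  rw [div_le_iff₀ (by positivity)]
  have h : 2 * min (y : ℕ) (2 ^ t - y) ≤ 2 ^ t := by omega
  have h' : 2 * ((min (y : ℕ) (2 ^ t - y) : ℕ) : ℝ) ≤ 2 ^ t := by exact_mod_cast h
  nlinarith [Real.pi_pos]

/-- Folding the circle onto `[0, π]` by `ω ↦ |ω|` does not increase distances. -/
theorem cos_sub_le_cos_abs_sub (t : ℕ) (ω : ℝ) (y : Fin (2 ^ t)) (hω : |ω| ≤ Real.pi) :
    Real.cos (ω - 2 * Real.pi * (y : ℕ) / 2 ^ t) ≤ Real.cos (|ω| - absPhase t y) := by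
  set α := 2 * Real.pi * ((y : ℕ) : ℝ) / 2 ^ t with hα
  have h : absPhase t y = α ∨ absPhase t y = 2 * Real.pi - α := by
    unfold absPhase
    rcases le_total (y : ℕ) (2 ^ t - y) with h | h
    · left; rw [min_eq_left h]
    · right
      rw [min_eq_right h, Nat.cast_sub y.2.le, hα]
      push_cast
      field_simp
  have hs0 : 0 ≤ Real.sin (absPhase t y) :=
    Real.sin_nonneg_of_nonneg_of_le_pi (absPhase_nonneg t y) (absPhase_le_pi t y)
  have hcos : Real.cos (absPhase t y) = Real.cos α := by
    rcases h with h | h <;> rw [h]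
    exact Real.cos_two_pi_sub α
  have hsin : Real.sin (absPhase t y) = |Real.sin α| := by
    rw [← abs_of_nonneg hs0]
    rcases h with h | h <;> rw [h]
    rw [Real.sin_two_pi_sub, abs_neg]
  have hsin2 : Real.sin |ω| = |Real.sin ω| := by
    rw [← abs_of_nonneg (Real.sin_nonneg_of_nonneg_of_le_pi (abs_nonneg ω) hω)]
    rcases abs_choice ω with h | h <;> rw [h]
    rw [Real.sin_neg, abs_neg]
  rw [Real.cos_sub, Real.cos_sub, hcos, hsin, hsin2, Real.cos_abs, ← abs_mul]
  gcongr
  exact le_abs_self _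

/-- The amplitude is a geometric sum `(w ^ N - 1) / (N (w - 1))` with `N = 2 ^ t`. The numerator has
norm at most 2, and `|w - 1| ≥ 2|Δ| / π` by the quadratic upper bound for the cosine on `[-π, π]`.
-/
theorem norm_sq_regAmp_le (t : ℕ) (ω : ℝ) (y : Fin (2 ^ t)) (hω : |ω| ≤ Real.pi)
    (hne : |ω| - absPhase t y ≠ 0) :
    ‖regAmp t ω y‖ ^ 2 ≤ 1 / (4 * (2 ^ t * |ω| / (2 * Real.pi)
      - ((min (y : ℕ) (2 ^ t - y) : ℕ) : ℝ)) ^ 2) := by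
  set x : ℝ := ω - 2 * Real.pi * (y : ℕ) / 2 ^ t with hx
  set w := Complex.exp (x * Complex.I) with hw
  have hN : (0 : ℝ) < 2 ^ t := by positivity
  have hpi := Real.pi_pos
  have hreg : regAmp t ω y = 1 / 2 ^ t * ∑ j ∈ Finset.range (2 ^ t), w ^ j := by
    rw [← Fin.sum_univ_eq_sum_range (fun j => w ^ j), Finset.mul_sum]
    refine Finset.sum_congr rfl fun j _ => ?_
    rw [← one_div_sqrt_mul_self, fourierKernel]
    have : w ^ (j : ℕ) = Complex.exp (-(2 * Real.pi * Complex.I * ((j : ℕ) : ℂ) * ((y : ℕ) : ℂ) / 2 ^ t))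
        * Complex.exp (ω * Complex.I) ^ (j : ℕ) := by
      rw [hw, ← Complex.exp_nat_mul, ← Complex.exp_nat_mul, ← Complex.exp_add]
      congr 1
      rw [hx]
      push_cast
      ring
    rw [this]
    ring
  set Δ := |ω| - absPhase t y with hΔ
  have hΔpi : |Δ| ≤ Real.pi := by
    have h1 := absPhase_nonneg t y
    have h2 := absPhase_le_pi t y
    have h3 := abs_nonneg ω
    rw [abs_le]; constructor <;> linarith
  have hcos : Real.cos x ≤ 1 - 2 / Real.pi ^ 2 * Δ ^ 2 :=
    (cos_sub_le_cos_abs_sub t ω y hω).trans (Real.cos_le_one_sub_mul_cos_sq hΔpi)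
  have hw1 : ‖w - 1‖ ^ 2 = 2 - 2 * Real.cos x := by
    rw [← Complex.normSq_eq_norm_sq, Complex.normSq_apply, Complex.sub_re, Complex.sub_im, hw,
      Complex.exp_ofReal_mul_I_re, Complex.exp_ofReal_mul_I_im, Complex.one_re, Complex.one_im]
    nlinarith [Real.sin_sq_add_cos_sq x]
  have hΔ2 : 0 < Δ ^ 2 := by positivity
  have hlow : 4 / Real.pi ^ 2 * Δ ^ 2 ≤ ‖w - 1‖ ^ 2 := by
    rw [hw1]
    have : 4 / Real.pi ^ 2 * Δ ^ 2 = 2 * (2 / Real.pi ^ 2 * Δ ^ 2) := by ring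
    linarith
  have hpos : 0 < ‖w - 1‖ ^ 2 := lt_of_lt_of_le (by positivity) hlow
  have hwne : w ≠ 1 := by
    rintro h
    rw [h] at hpos; simp at hpos
  have hwn : ‖w‖ = 1 := Complex.norm_exp_ofReal_mul_I x
  have hnum : ‖w ^ (2 ^ t) - 1‖ ^ 2 ≤ 4 := by
    have h1 : ‖w ^ (2 ^ t) - 1‖ ≤ 2 := by
      refine (norm_sub_le _ _).trans ?_
      rw [norm_pow, hwn]; norm_num
    nlinarith [norm_nonneg (w ^ (2 ^ t) - 1)]
  have hu : 2 ^ t * |ω| / (2 * Real.pi) - ((min (y : ℕ) (2 ^ t - y) : ℕ) : ℝ)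
      = 2 ^ t / (2 * Real.pi) * Δ := by
    rw [hΔ, absPhase]
    field_simp
  have h2 : ‖(1 / 2 ^ t : ℂ)‖ ^ 2 = 1 / (2 ^ t) ^ 2 := by simp
  rw [hreg, geom_sum_eq hwne, norm_mul, mul_pow, h2, norm_div, div_pow, hu]
  calc 1 / (2 ^ t) ^ 2 * (‖w ^ 2 ^ t - 1‖ ^ 2 / ‖w - 1‖ ^ 2)
      ≤ 1 / (2 ^ t) ^ 2 * (4 / (4 / Real.pi ^ 2 * Δ ^ 2)) := by gcongr
    _ = 1 / (4 * (2 ^ t / (2 * Real.pi) * Δ) ^ 2) := by field_simp; norm_num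

/-- With `2 ^ t ≥ 512 / θ`, an estimate is off by `θ / 4` or more with probability at most
`1 / 15`. -/
theorem sum_norm_sq_regAmp_bad_le (t : ℕ) (θ ω : ℝ) (hθ : 0 < θ) (ht : 512 / θ ≤ 2 ^ t)
    (hω : |ω| ≤ Real.pi) :
    ∑ y, (if θ / 4 ≤ |(|ω| - absPhase t y)| then ‖regAmp t ω y‖ ^ 2 else 0) ≤ 1 / 15 := by
  have hpi := Real.pi_pos
  set u := 2 ^ t * |ω| / (2 * Real.pi) with hu
  set D := 2 ^ t * θ / (8 * Real.pi) with hD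
  -- This is where 512 enters: `512 / (8π) ≥ 16` because `π < 4`. The two tails then add up to at
  -- most `1 / (D - 1 / 2) ≤ 1 / 15`.
  have hD16 : 16 ≤ D := by
    rw [hD, le_div_iff₀ (by positivity)]
    rw [div_le_iff₀ hθ] at ht
    nlinarith [Real.pi_lt_four]
  let g : ℕ → ℝ := fun q => if D ≤ |u - q| then 1 / (4 * (u - q) ^ 2) else 0
  have hg0 : ∀ q, 0 ≤ g q := fun q => by
    simp only [g]; split_ifs <;> positivity
  have htail := sum_range_tail_le u D (by linarith)
  -- The folded estimate is `y` or `2 ^ t - y`; adding both tail terms avoids deciding which.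
  have hterm : ∀ y : Fin (2 ^ t),
      (if θ / 4 ≤ |(|ω| - absPhase t y)| then ‖regAmp t ω y‖ ^ 2 else 0)
        ≤ g y + g (2 ^ t - y) := by
    intro y
    split_ifs with h
    · have hΔ : |ω| - absPhase t y ≠ 0 := by
        intro h0
        rw [h0, abs_zero] at h; linarith
      have hle := norm_sq_regAmp_le t ω y hω hΔ
      have hdist : D ≤ |u - ((min (y : ℕ) (2 ^ t - y) : ℕ) : ℝ)| := by
        have : u - ((min (y : ℕ) (2 ^ t - y) : ℕ) : ℝ)
            = 2 ^ t / (2 * Real.pi) * (|ω| - absPhase t y) := by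
          rw [hu, absPhase]
          field_simp
        rw [this, abs_mul, abs_of_pos (by positivity : (0 : ℝ) < 2 ^ t / (2 * Real.pi))]
        calc D = 2 ^ t / (2 * Real.pi) * (θ / 4) := by rw [hD]; field_simp; norm_num
          _ ≤ _ := by gcongr
      have hmin : ‖regAmp t ω y‖ ^ 2 ≤ g (min (y : ℕ) (2 ^ t - y)) := by
        simp only [g]
        rwa [if_pos hdist]
      rcases min_choice (y : ℕ) (2 ^ t - y) with h | h <;> rw [h] at hmin
      · linarith [hg0 (2 ^ t - y)]
      · linarith [hg0 y]
    · exact add_nonneg (hg0 _) (hg0 _)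
  have h1 : ∑ y : Fin (2 ^ t), g y ≤ 1 / (2 * (D - 1 / 2)) := by
    rw [Fin.sum_univ_eq_sum_range g]
    exact htail _
  -- Here the argument runs over `1, …, 2 ^ t`, hence the tail bound with one more term, whose index
  -- 0 is discarded.
  have h2 : ∑ y : Fin (2 ^ t), g (2 ^ t - y) ≤ 1 / (2 * (D - 1 / 2)) := by
    rw [Fin.sum_univ_eq_sum_range (fun y => g (2 ^ t - y)),
      ← Finset.sum_range_reflect]
    refine le_trans ?_ (htail (2 ^ t + 1))
    rw [Finset.sum_range_succ']
    refine le_trans (Finset.sum_le_sum fun q hq => ?_) (le_add_of_nonneg_right (hg0 0))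
    have : 2 ^ t - (2 ^ t - 1 - q) = q + 1 := by
      have := Finset.mem_range.1 hq
      omega
    rw [this]
  refine (Finset.sum_le_sum fun y _ => hterm y).trans ?_
  rw [Finset.sum_add_distrib]
  refine (add_le_add h1 h2).trans ?_
  rw [← two_mul, ← mul_div_assoc, div_le_div_iff₀ (by linarith) (by norm_num)]
  linarith

/-! ### The median vote -/

open Classical in
/-- Chernoff bound for the majority of `K` independent samples. -/
theorem sum_prod_majority_le {Y : Type*} [Fintype Y] (K : ℕ) (P : Y → ℝ) (bad : Y → Prop)
    (hP : ∀ y, 0 ≤ P y) (hsum : ∑ y, P y = 1)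
    (hbad : ∑ y, (if bad y then P y else 0) ≤ 1 / 15) :
    ∑ y : Fin K → Y with K ≤ 2 * (Finset.univ.filter fun k => bad (y k)).card, ∏ k, P (y k)
      ≤ (1 / 2) ^ K := by
  -- Exponential moment with weight 16 per bad sample: if at least half are bad, then `16 ^ #bad ≥ 4
  -- ^ K`. One sample has moment at most `1 + 15 / 15 = 2`, which gives `(2 / 4) ^ K`.
  have hterm : ∀ y : Fin K → Y,
      (if K ≤ 2 * (Finset.univ.filter fun k => bad (y k)).card then ∏ k, P (y k) else 0)
        ≤ (1 / 4) ^ K * ∏ k, (P (y k) * if bad (y k) then 16 else 1) := by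
    intro y
    have h0 : 0 ≤ ∏ k, P (y k) := Finset.prod_nonneg fun k _ => hP _
    have hprod : (∏ k, if bad (y k) then (16 : ℝ) else 1)
        = 4 ^ (2 * (Finset.univ.filter fun k => bad (y k)).card) := by
      rw [Finset.prod_ite, Finset.prod_const, Finset.prod_const_one, mul_one, pow_mul]
      norm_num
    rw [Finset.prod_mul_distrib, hprod]
    split_ifs with h
    · have h4 : (4 : ℝ) ^ K ≤ 4 ^ (2 * (Finset.univ.filter fun k => bad (y k)).card) :=
        pow_le_pow_right₀ (by norm_num) h
      calc ∏ k, P (y k) = (1 / 4) ^ K * ((∏ k, P (y k)) * 4 ^ K) := by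
            rw [mul_left_comm, ← mul_pow]; norm_num
        _ ≤ _ := by gcongr
    · positivity
  rw [Finset.sum_filter]
  refine (Finset.sum_le_sum fun y _ => hterm y).trans ?_
  rw [← Finset.mul_sum]
  have hpow : ∑ y : Fin K → Y, ∏ k, (P (y k) * if bad (y k) then 16 else 1)
      = (∑ y, P y * if bad y then 16 else 1) ^ K := by
    rw [Finset.sum_pow', Fintype.piFinset_univ]
  have hle : ∑ y, P y * (if bad y then 16 else 1) ≤ 2 := by
    have : ∀ y, P y * (if bad y then 16 else 1) = P y + 15 * if bad y then P y else 0 := by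
      intro y; split_ifs <;> ring
    simp_rw [this]
    rw [Finset.sum_add_distrib, ← Finset.mul_sum, hsum]
    linarith
  have hnn : 0 ≤ ∑ y, P y * (if bad y then 16 else 1) :=
    Finset.sum_nonneg fun y _ => mul_nonneg (hP y) (by split_ifs <;> norm_num)
  rw [hpow, ← mul_pow]
  exact pow_le_pow_left₀ (by positivity) (by linarith) _

theorem sum_prod_eq_one {Y : Type*} [Fintype Y] (K : ℕ) (P : Y → ℝ) (hsum : ∑ y, P y = 1) :
    ∑ y : Fin K → Y, ∏ k, P (y k) = 1 := by
  have h := Finset.sum_pow' (Finset.univ : Finset Y) P K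
  rw [hsum, one_pow, Fintype.piFinset_univ] at h
  exact h.symm

open Classical in
/-- The probability of the outcome "phase `0`" on an eigenvector with eigenvalue `exp (i ω)`. -/
def eigenProb (t K : ℕ) (θ ω : ℝ) : ℝ :=
  ∑ y : Registers t K with IsPhaseZero t K θ y, ∏ k, ‖regAmp t ω (y k)‖ ^ 2

theorem eigenProb_nonneg (t K : ℕ) (θ ω : ℝ) : 0 ≤ eigenProb t K θ ω :=
  Finset.sum_nonneg fun _ _ => Finset.prod_nonneg fun _ _ => by positivity

open Classical in
theorem eigenProb_le_one (t K : ℕ) (θ ω : ℝ) : eigenProb t K θ ω ≤ 1 := by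
  rw [← sum_prod_eq_one K (fun y => ‖regAmp t ω y‖ ^ 2) (sum_norm_sq_regAmp t ω)]
  exact Finset.sum_le_sum_of_subset_of_nonneg (Finset.filter_subset _ _)
    fun _ _ _ => Finset.prod_nonneg fun _ _ => by positivity

open Classical in
theorem isPhaseZero_iff (t K : ℕ) (θ : ℝ) (y : Registers t K) :
    IsPhaseZero t K θ y ↔
      K < 2 * (Finset.univ.filter fun k => absPhase t (y k) ≤ 3 * θ / 4).card := by
  rw [IsPhaseZero, ← Set.ncard_coe_finset]
  simp

open Classical in
-- The threshold `3θ / 4` is more than `θ / 4` away from an estimate that misses it only if that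
-- estimate errs: each rejected one is off by more than `θ / 4`. A tied vote rejects, and the
-- majority bound covers ties.
theorem le_eigenProb {t : ℕ} (K : ℕ) {θ ω : ℝ} (hθ : 0 < θ) (ht : 512 / θ ≤ 2 ^ t)
    (hω : |ω| ≤ Real.pi) (hω' : |ω| ≤ θ / 2) : 1 - (1 / 2) ^ K ≤ eigenProb t K θ ω := by
  have hmaj := sum_prod_majority_le K (fun y => ‖regAmp t ω y‖ ^ 2)
    (fun y => θ / 4 ≤ |(|ω| - absPhase t y)|) (fun y => by positivity)
    (sum_norm_sq_regAmp t ω) (sum_norm_sq_regAmp_bad_le t θ ω hθ ht hω)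
  have hone := sum_prod_eq_one K (fun y => ‖regAmp t ω y‖ ^ 2) (sum_norm_sq_regAmp t ω)
  rw [← Finset.sum_filter_add_sum_filter_not Finset.univ (fun y => IsPhaseZero t K θ y)] at hone
  have hle : ∑ y : Registers t K with ¬ IsPhaseZero t K θ y, ∏ k, ‖regAmp t ω (y k)‖ ^ 2
      ≤ (1 / 2) ^ K := by
    refine le_trans (Finset.sum_le_sum_of_subset_of_nonneg (fun y hy => ?_)
      fun _ _ _ => Finset.prod_nonneg fun _ _ => by positivity) hmaj
    simp only [Finset.mem_filter, Finset.mem_univ, true_and, isPhaseZero_iff, not_lt] at hy ⊢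
    have h1 := Finset.card_filter_add_card_filter_not (s := (Finset.univ : Finset (Fin K)))
      (fun k => absPhase t (y k) ≤ 3 * θ / 4)
    have h2 : (Finset.univ.filter fun k => ¬ absPhase t (y k) ≤ 3 * θ / 4).card
        ≤ (Finset.univ.filter fun k => θ / 4 ≤ |(|ω| - absPhase t (y k))|).card := by
      refine Finset.card_le_card fun k hk => ?_
      simp only [Finset.mem_filter, Finset.mem_univ, true_and, not_le] at hk ⊢
      rw [le_abs]
      right; linarith
    rw [Finset.card_univ, Fintype.card_fin] at h1
    omega
  unfold eigenProb
  linarith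

open Classical in
theorem eigenProb_le {t : ℕ} (K : ℕ) {θ ω : ℝ} (hθ : 0 < θ) (ht : 512 / θ ≤ 2 ^ t)
    (hω : |ω| ≤ Real.pi) (hω' : θ ≤ |ω|) : eigenProb t K θ ω ≤ (1 / 2) ^ K := by
  have hmaj := sum_prod_majority_le K (fun y => ‖regAmp t ω y‖ ^ 2)
    (fun y => θ / 4 ≤ |(|ω| - absPhase t y)|) (fun y => by positivity)
    (sum_norm_sq_regAmp t ω) (sum_norm_sq_regAmp_bad_le t θ ω hθ ht hω)
  refine le_trans (Finset.sum_le_sum_of_subset_of_nonneg (fun y hy => ?_)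
    fun _ _ _ => Finset.prod_nonneg fun _ _ => by positivity) hmaj
  simp only [Finset.mem_filter, Finset.mem_univ, true_and, isPhaseZero_iff] at hy ⊢
  refine hy.le.trans (Nat.mul_le_mul_left 2 (Finset.card_le_card fun k hk => ?_))
  simp only [Finset.mem_filter, Finset.mem_univ, true_and] at hk ⊢
  rw [le_abs]
  left; linarith

/-! ### Phase estimation in an eigenbasis -/

section Estimation

variable {E : Type*} [NormedAddCommGroup E] [InnerProductSpace ℂ E] {ι : Type*} [Fintype ι]

theorem repr_pow_apply {U : E →L[ℂ] E} {b : OrthonormalBasis ι ℂ E} {ω : ι → ℝ}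
    (hb : ∀ a, U (b a) = Complex.exp (ω a * Complex.I) • b a) (s : ℕ) (v : E) (a : ι) :
    b.repr ((U ^ s) v) a = Complex.exp (ω a * Complex.I) ^ s * b.repr v a := by
  classical
  have hpow : ∀ c, (U ^ s) (b c) = Complex.exp (ω c * Complex.I) ^ s • b c := by
    intro c
    induction s with
    | zero => simp
    | succ s ih => rw [pow_succ, mul_apply_eq_comp, hb, map_smul, ih, smul_smul, pow_succ']
  conv_lhs => rw [← b.sum_repr v]
  simp only [map_sum, map_smul, hpow, OrthonormalBasis.repr_self, WithLp.ofLp_sum, Finset.sum_apply,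
    PiLp.smul_apply, smul_eq_mul, PiLp.single_apply]
  rw [Finset.sum_eq_single a]
  · simp [mul_comm]
  · intro c _ hc
    simp [hc.symm]
  · simp

/-- On an eigenvector the controlled power is the scalar `exp (i ω) ^ ∑ j k`, a product over the
registers, so the sum over `j` factorizes. -/
theorem repr_phaseEstimationState {U : E →L[ℂ] E} {b : OrthonormalBasis ι ℂ E} {ω : ι → ℝ}
    (hb : ∀ a, U (b a) = Complex.exp (ω a * Complex.I) • b a) (t K : ℕ) (v : E)
    (y : Registers t K) (a : ι) :
    b.repr (phaseEstimationState t K U v y) a = (∏ k, regAmp t (ω a) (y k)) * b.repr v a := by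
  simp only [phaseEstimationState, inverseFourier, controlledPowers, uniformRegisters, map_sum,
    map_smul, repr_pow_apply hb, WithLp.ofLp_sum, Finset.sum_apply, PiLp.smul_apply, smul_eq_mul]
  unfold regAmp
  rw [Finset.prod_univ_sum, Fintype.piFinset_univ, Finset.sum_mul]
  refine Finset.sum_congr rfl fun j _ => ?_
  simp only [fourierKernel, Finset.prod_mul_distrib, Finset.prod_pow_eq_pow_sum,
    Complex.ofReal_prod]
  ring

/-- Different eigenvectors stay orthogonal in the system, so their contributions do not interfere.
-/
theorem probPhaseZero_eq_sum {U : E →L[ℂ] E} {b : OrthonormalBasis ι ℂ E} {ω : ι → ℝ}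
    (hb : ∀ a, U (b a) = Complex.exp (ω a * Complex.I) • b a) (t K : ℕ) (θ : ℝ) (v : E) :
    probPhaseZero t K θ U v = ∑ a, ‖b.repr v a‖ ^ 2 * eigenProb t K θ (ω a) := by
  classical
  unfold probPhaseZero eigenProb
  simp_rw [Finset.mul_sum]
  rw [Finset.sum_comm]
  refine Finset.sum_congr (by congr) fun y _ => ?_
  rw [← b.repr.norm_map, EuclideanSpace.norm_sq_eq]
  refine Finset.sum_congr rfl fun a _ => ?_
  rw [repr_phaseEstimationState hb, norm_mul, mul_pow, norm_prod, Finset.prod_pow, mul_comm]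

open Classical in
/-- The coordinates of a vector with labels in `S`: the spectral projection onto `S`. -/
def spectralCut (b : OrthonormalBasis ι ℂ E) (S : Set ι) : E →ₗ[ℂ] EuclideanSpace ℂ ι where
  toFun v := WithLp.toLp 2 fun a => if a ∈ S then b.repr v a else 0
  map_add' v w := by
    ext a
    by_cases h : a ∈ S <;> simp [h]
  map_smul' c v := by
    ext a
    by_cases h : a ∈ S <;> simp [h]

open Classical in
theorem norm_sq_spectralCut (b : OrthonormalBasis ι ℂ E) (S : Set ι) (v : E) :
    ‖spectralCut b S v‖ ^ 2 = ∑ a, if a ∈ S then ‖b.repr v a‖ ^ 2 else 0 := by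
  rw [EuclideanSpace.norm_sq_eq]
  refine Finset.sum_congr rfl fun a _ => ?_
  by_cases h : a ∈ S <;> simp [spectralCut, h]

theorem norm_sq_eq_sum_repr (b : OrthonormalBasis ι ℂ E) (v : E) :
    ‖v‖ ^ 2 = ∑ a, ‖b.repr v a‖ ^ 2 := by
  rw [← b.repr.norm_map, EuclideanSpace.norm_sq_eq]

theorem norm_spectralCut_le (b : OrthonormalBasis ι ℂ E) (S : Set ι) (v : E) :
    ‖spectralCut b S v‖ ≤ ‖v‖ := by
  classical
  rw [← pow_le_pow_iff_left₀ (norm_nonneg _) (norm_nonneg _) two_ne_zero, norm_sq_spectralCut,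
    norm_sq_eq_sum_repr b]
  refine Finset.sum_le_sum fun a _ => ?_
  split_ifs <;> simp

theorem norm_sq_one_sub_exp (x : ℝ) :
    ‖1 - Complex.exp (x * Complex.I)‖ ^ 2 = 2 - 2 * Real.cos x := by
  rw [← Complex.normSq_eq_norm_sq, Complex.normSq_apply, Complex.sub_re, Complex.sub_im,
    Complex.exp_ofReal_mul_I_re, Complex.exp_ofReal_mul_I_im, Complex.one_re, Complex.one_im]
  nlinarith [Real.sin_sq_add_cos_sq x]

theorem repr_sub_apply {U : E →L[ℂ] E} {b : OrthonormalBasis ι ℂ E} {ω : ι → ℝ}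
    (hb : ∀ a, U (b a) = Complex.exp (ω a * Complex.I) • b a) (v : E) (a : ι) :
    ‖b.repr (v - U v) a‖ ^ 2 = (2 - 2 * Real.cos (ω a)) * ‖b.repr v a‖ ^ 2 := by
  have h := repr_pow_apply hb 1 v a
  rw [pow_one, pow_one] at h
  rw [map_sub, PiLp.sub_apply, h, ← norm_sq_one_sub_exp, ← mul_pow, ← norm_mul]
  congr 2
  ring

/-- Each coordinate of `v - U v` carries the factor `|1 - exp (i ω)| ≤ |ω|`. -/
theorem norm_spectralCut_sub_le {U : E →L[ℂ] E} {b : OrthonormalBasis ι ℂ E} {ω : ι → ℝ}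
    (hb : ∀ a, U (b a) = Complex.exp (ω a * Complex.I) • b a) {θ : ℝ} (hθ : 0 < θ) (v : E) :
    ‖spectralCut b {a | |ω a| < θ} (v - U v)‖ ≤ θ * ‖v‖ := by
  classical
  rw [← pow_le_pow_iff_left₀ (norm_nonneg _) (by positivity) two_ne_zero, norm_sq_spectralCut,
    mul_pow, norm_sq_eq_sum_repr b, Finset.mul_sum]
  refine Finset.sum_le_sum fun a _ => ?_
  split_ifs with h
  · rw [repr_sub_apply hb]
    have h1 := Real.one_sub_sq_div_two_le_cos (x := ω a)
    replace h : |ω a| < θ := h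
    have h2 : ω a ^ 2 ≤ θ ^ 2 := sq_le_sq' (by linarith [(abs_lt.1 h).1]) (abs_lt.1 h).2.le
    gcongr
    linarith
  · positivity

/-- Source of the constant 5: at `θ / 2` the leading term is `θ² / 4`, and for `θ ≤ 1` the quartic
error costs less than `θ² / 20`. -/
theorem two_sub_two_mul_cos_ge {θ x : ℝ} (hθ : 0 < θ) (hθ1 : θ ≤ 1) (hx : |x| ≤ Real.pi)
    (hx' : θ / 2 < |x|) : θ ^ 2 / 5 ≤ 2 - 2 * Real.cos x := by
  have h1 : Real.cos x ≤ Real.cos (θ / 2) := by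
    rw [← Real.cos_abs x]
    exact Real.cos_le_cos_of_nonneg_of_le_pi (by linarith) hx hx'.le
  have h2 := (abs_le.1 (Real.cos_bound (x := θ / 2) (by rw [abs_of_pos] <;> linarith))).2
  rw [abs_of_pos (by linarith : 0 < θ / 2)] at h2
  have h3 : θ ^ 4 ≤ θ ^ 2 := pow_le_pow_of_le_one hθ.le hθ1 (by norm_num)
  have h4 : (θ / 2) ^ 4 = θ ^ 4 / 16 := by ring
  rw [h4] at h2
  nlinarith

theorem norm_sq_sub_le_spectralCut {U : E →L[ℂ] E} {b : OrthonormalBasis ι ℂ E} {ω : ι → ℝ}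
    (hb : ∀ a, U (b a) = Complex.exp (ω a * Complex.I) • b a) (hω : ∀ a, |ω a| ≤ Real.pi)
    {θ ε : ℝ} (hθ : 0 < θ) (hθ1 : θ ≤ 1) (v : E) (hv : ‖v - U v‖ ≤ ε) :
    ‖v‖ ^ 2 - 5 * ε ^ 2 / θ ^ 2 ≤ ‖spectralCut b {a | |ω a| ≤ θ / 2} v‖ ^ 2 := by
  classical
  have h1 : ‖v‖ ^ 2 ≤ ‖spectralCut b {a | |ω a| ≤ θ / 2} v‖ ^ 2 + 5 / θ ^ 2 * ‖v - U v‖ ^ 2 := by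
    rw [norm_sq_spectralCut, norm_sq_eq_sum_repr b v, norm_sq_eq_sum_repr b (v - U v),
      Finset.mul_sum, ← Finset.sum_add_distrib]
    refine Finset.sum_le_sum fun a _ => ?_
    rw [repr_sub_apply hb]
    split_ifs with h
    · have : 0 ≤ 2 - 2 * Real.cos (ω a) := by linarith [Real.cos_le_one (ω a)]
      exact le_add_of_nonneg_right (by positivity)
    · have h2 := two_sub_two_mul_cos_ge hθ hθ1 (hω a) (not_le.1 h)
      rw [zero_add, ← mul_assoc]
      refine le_mul_of_one_le_left (by positivity) ?_
      calc (1 : ℝ) = 5 / θ ^ 2 * (θ ^ 2 / 5) := by field_simp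
        _ ≤ _ := by gcongr
  have h2 : 5 / θ ^ 2 * ‖v - U v‖ ^ 2 ≤ 5 * ε ^ 2 / θ ^ 2 := by
    rw [div_mul_eq_mul_div]
    gcongr
  linarith

theorem spectralCut_le_probPhaseZero {U : E →L[ℂ] E} {b : OrthonormalBasis ι ℂ E} {ω : ι → ℝ}
    (hb : ∀ a, U (b a) = Complex.exp (ω a * Complex.I) • b a) (hω : ∀ a, |ω a| ≤ Real.pi)
    {t K : ℕ} {θ δ : ℝ} (hθ : 0 < θ) (ht : 512 / θ ≤ 2 ^ t) (hK : (1 / 2) ^ K ≤ δ) (v : E) :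
    ‖spectralCut b {a | |ω a| ≤ θ / 2} v‖ ^ 2 * (1 - δ) ≤ probPhaseZero t K θ U v := by
  classical
  rw [probPhaseZero_eq_sum hb, norm_sq_spectralCut, Finset.sum_mul]
  refine Finset.sum_le_sum fun a _ => ?_
  split_ifs with h
  · have := le_eigenProb K hθ ht (hω a) h
    gcongr
    linarith
  · rw [zero_mul]
    exact mul_nonneg (by positivity) (eigenProb_nonneg _ _ _ _)

theorem probPhaseZero_le_spectralCut {U : E →L[ℂ] E} {b : OrthonormalBasis ι ℂ E} {ω : ι → ℝ}
    (hb : ∀ a, U (b a) = Complex.exp (ω a * Complex.I) • b a) (hω : ∀ a, |ω a| ≤ Real.pi)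
    {t K : ℕ} {θ δ : ℝ} (hθ : 0 < θ) (ht : 512 / θ ≤ 2 ^ t) (hK : (1 / 2) ^ K ≤ δ) (v : E)
    (hv : ‖v‖ = 1) :
    probPhaseZero t K θ U v ≤ ‖spectralCut b {a | |ω a| < θ} v‖ ^ 2 + δ := by
  classical
  have hδ : δ = ∑ a, δ * ‖b.repr v a‖ ^ 2 := by
    rw [← Finset.mul_sum, ← norm_sq_eq_sum_repr, hv, one_pow, mul_one]
  have hδ0 : 0 ≤ δ := le_trans (by positivity) hK
  conv_rhs => rw [hδ]
  rw [probPhaseZero_eq_sum hb, norm_sq_spectralCut, ← Finset.sum_add_distrib]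
  refine Finset.sum_le_sum fun a _ => ?_
  -- Nothing better than probability 1 is known between `θ / 2` and `θ`, so the window here extends
  -- to `θ`.
  split_ifs with h
  · refine le_trans (mul_le_of_le_one_right (by positivity) (eigenProb_le_one _ _ _ _)) ?_
    exact le_add_of_nonneg_right (by positivity)
  · rw [zero_add, mul_comm]
    gcongr
    exact (eigenProb_le K hθ ht (hω a) (not_lt.1 h)).trans hK

/-! ### Overlap bounds -/

/-- A vector `ψ = (e₀ + η) / √ν` that is almost fixed by `U` forces `e₀` to have a large component
in the spectral subspace of small phases. -/
theorem overlap_sq_le_spectralCut {U : E →L[ℂ] E} {b : OrthonormalBasis ι ℂ E} {ω : ι → ℝ}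
    (hb : ∀ a, U (b a) = Complex.exp (ω a * Complex.I) • b a) (hω : ∀ a, |ω a| ≤ Real.pi)
    {θ ε ν : ℝ} (hθ : 0 < θ) (hθ1 : θ ≤ 1) (hν : 0 < ν) {e₀ η ψ : E} (he : ‖e₀‖ = 1)
    (horth : inner ℂ η e₀ = 0) (hψ : ψ = ((1 / Real.sqrt ν : ℝ) : ℂ) • (e₀ + η))
    (hε : ‖ψ - U ψ‖ ≤ ε) :
    max 0 (Real.sqrt (ν * (‖ψ‖ ^ 2 - 5 * ε ^ 2 / θ ^ 2)) - Real.sqrt (ν * ‖ψ‖ ^ 2 - 1)) ^ 2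
      ≤ ‖spectralCut b {a | |ω a| ≤ θ / 2} e₀‖ ^ 2 := by
  have hs : 0 < Real.sqrt ν := Real.sqrt_pos.2 hν
  have hν2 : Real.sqrt ν ^ 2 = ν := Real.sq_sqrt hν.le
  have hsum : ((Real.sqrt ν : ℝ) : ℂ) • ψ = e₀ + η := by
    rw [hψ, smul_smul, ← Complex.ofReal_mul, mul_one_div_cancel hs.ne', Complex.ofReal_one, one_smul]
  have hnormsq : ν * ‖ψ‖ ^ 2 = 1 + ‖η‖ ^ 2 := by
    have h1 : ‖((Real.sqrt ν : ℝ) : ℂ) • ψ‖ ^ 2 = ν * ‖ψ‖ ^ 2 := by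
      rw [norm_smul, mul_pow, Complex.norm_real, Real.norm_eq_abs, sq_abs, hν2]
    have h2 := norm_add_sq_eq_norm_sq_add_norm_sq_of_inner_eq_zero (𝕜 := ℂ) η e₀ horth
    rw [← h1, hsum, add_comm e₀ η, sq, h2, he, sq]
    ring
  have hη : Real.sqrt (ν * ‖ψ‖ ^ 2 - 1) = ‖η‖ := by
    rw [hnormsq, add_sub_cancel_left, Real.sqrt_sq (norm_nonneg _)]
  have hcut := norm_sq_sub_le_spectralCut hb hω hθ hθ1 ψ hε
  set P := spectralCut b {a | |ω a| ≤ θ / 2} with hP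
  -- `Real.sqrt` is 0 on negative arguments and so takes the positive part; the bound needs no sign
  -- condition.
  have hfirst : Real.sqrt (ν * (‖ψ‖ ^ 2 - 5 * ε ^ 2 / θ ^ 2)) ≤ Real.sqrt ν * ‖P ψ‖ := by
    rw [Real.sqrt_mul hν.le]
    gcongr
    exact (Real.sqrt_le_sqrt hcut).trans_eq (Real.sqrt_sq (norm_nonneg _))
  have htri : Real.sqrt ν * ‖P ψ‖ ≤ ‖P e₀‖ + ‖η‖ := by
    have h1 : Real.sqrt ν * ‖P ψ‖ = ‖P (((Real.sqrt ν : ℝ) : ℂ) • ψ)‖ := by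
      rw [map_smul, norm_smul, Complex.norm_real, Real.norm_of_nonneg hs.le]
    rw [h1, hsum, map_add]
    exact (norm_add_le _ _).trans (by gcongr; exact norm_spectralCut_le _ _ _)
  refine pow_le_pow_left₀ (le_max_left _ _) (max_le (norm_nonneg _) ?_) 2
  rw [hη]
  linarith

end Estimation

/-! ### The walk operator -/

section Walk

variable {n m : ℕ}

/-- The sign by which the reflection `2 Π_x - I` multiplies a basis vector. -/
def reflSign (x : Fin n → Bool) : Idx n m → ℂ
  | Sum.inl _ => 1
  | Sum.inr (i, _, b) => if b = x i then 1 else -1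

theorem norm_reflSign (x : Fin n → Bool) (p : Idx n m) : ‖reflSign x p‖ = 1 := by
  rcases p with _ | ⟨i, k, b⟩
  · simp [reflSign]
  · simp only [reflSign]
    split_ifs <;> simp

theorem two_smul_proj_sub_one_apply (x : Fin n → Bool) (v : Space n m) (p : Idx n m) :
    (((2 : ℂ) • proj x - 1) v) p = reflSign x p * v p := by
  rcases p with _ | ⟨i, k, b⟩
  · simp [proj, reflSign, Matrix.ofLp_toEuclideanCLM, Matrix.mulVec_diagonal]
    ring
  · by_cases h : b = x i
    · simp [proj, reflSign, Matrix.ofLp_toEuclideanCLM, Matrix.mulVec_diagonal, h]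
      ring
    · simp [proj, reflSign, Matrix.ofLp_toEuclideanCLM, Matrix.mulVec_diagonal, h]

theorem walk_apply (R : Space n m →L[ℂ] Space n m) (x : Fin n → Bool) (v : Space n m)
    (p : Idx n m) : walk R x v p = reflSign x p * R v p :=
  two_smul_proj_sub_one_apply x (R v) p

theorem norm_two_smul_proj_sub_one (x : Fin n → Bool) (v : Space n m) :
    ‖((2 : ℂ) • proj x - 1) v‖ = ‖v‖ := by
  simp only [EuclideanSpace.norm_eq, two_smul_proj_sub_one_apply, norm_mul, norm_reflSign, one_mul]

theorem norm_ket0 : ‖ket0 n m‖ = 1 := by simp [ket0]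

theorem proj_ket0 (x : Fin n → Bool) : proj x (ket0 n m) = ket0 n m := by
  ext p
  rcases p with _ | ⟨i, k, b⟩ <;>
    simp [proj, ket0, Matrix.ofLp_toEuclideanCLM, Matrix.mulVec_diagonal]

theorem norm_walk {R : Space n m →L[ℂ] Space n m}
    (hR : R ∈ unitary (Space n m →L[ℂ] Space n m)) (x : Fin n → Bool) (v : Space n m) :
    ‖walk R x v‖ = ‖v‖ :=
  (norm_two_smul_proj_sub_one x (R v)).trans (ContinuousLinearMap.norm_map_of_mem_unitary hR v)

/-- The walk operator has an orthonormal basis of eigenvectors. -/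
theorem exists_walk_eigenbasis {R : Space n m →L[ℂ] Space n m}
    (hR : R ∈ unitary (Space n m →L[ℂ] Space n m)) (x : Fin n → Bool) :
    ∃ (N : ℕ) (b : OrthonormalBasis (Fin N) ℂ (Space n m)) (ω : Fin N → ℝ),
      (∀ a, |ω a| ≤ Real.pi) ∧
        ∀ a, walk R x (b a) = Complex.exp (ω a * Complex.I) • b a :=
  ⟨_, exists_orthonormalBasis_exp ⟨(walk R x).toLinearMap, norm_walk hR x⟩⟩

/-- If `φ = (|0̂⟩ + η) / √μ` is almost reversed by `R` and `Π_x η = 0`, then `|0̂⟩` has a small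
component in the spectral subspace of small phases. -/
theorem norm_sq_spectralCut_ket0_le {ι : Type*} [Fintype ι] {R : Space n m →L[ℂ] Space n m}
    {x : Fin n → Bool} {b : OrthonormalBasis ι ℂ (Space n m)} {ω : ι → ℝ}
    (hb : ∀ a, walk R x (b a) = Complex.exp (ω a * Complex.I) • b a) {θ ε μ : ℝ} (hθ : 0 < θ)
    (hμ : 0 < μ) {η φ : Space n m} (hφ : φ = ((1 / Real.sqrt μ : ℝ) : ℂ) • (ket0 n m + η))
    (hη : proj x η = 0) (hε : ‖φ + R φ‖ ≤ ε) :
    ‖spectralCut b {a | |ω a| < θ} (ket0 n m)‖ ^ 2 ≤ μ * (ε / 2 + θ / 2 * ‖φ‖) ^ 2 := by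
  have hs : 0 < Real.sqrt μ := Real.sqrt_pos.2 hμ
  have hket : ((Real.sqrt μ : ℝ) : ℂ) • proj x φ = ket0 n m := by
    rw [hφ, map_smul, map_add, hη, add_zero, proj_ket0, smul_smul, ← Complex.ofReal_mul,
      mul_one_div_cancel hs.ne', Complex.ofReal_one, one_smul]
  set e := φ + R φ with he
  -- The terms `Uφ` cancel. The first bracket is small on small phases, and the reflection preserves
  -- the norm of the error `e`.
  have hproj : proj x φ = (1 / 2 : ℂ) • ((φ - walk R x φ) + ((2 : ℂ) • proj x - 1) e) := by
    have h1 : walk R x φ = (2 : ℂ) • proj x (R φ) - R φ := rfl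
    have h2 : ((2 : ℂ) • proj x - 1) e = (2 : ℂ) • proj x e - e := rfl
    rw [h1, h2, he, map_add]
    module
  set P := spectralCut b {a | |ω a| < θ} with hP
  have hbound : ‖P (proj x φ)‖ ≤ ε / 2 + θ / 2 * ‖φ‖ := by
    have h1 : ‖P (φ - walk R x φ)‖ ≤ θ * ‖φ‖ := norm_spectralCut_sub_le hb hθ φ
    have h2 : ‖P (((2 : ℂ) • proj x - 1) e)‖ ≤ ε :=
      (norm_spectralCut_le _ _ _).trans ((norm_two_smul_proj_sub_one x e).le.trans hε)
    rw [hproj, map_smul, norm_smul, map_add]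
    have h3 : ‖(1 / 2 : ℂ)‖ = 1 / 2 := by simp
    rw [h3]
    linarith [norm_add_le (P (φ - walk R x φ)) (P (((2 : ℂ) • proj x - 1) e))]
  have hnorm : ‖P (ket0 n m)‖ = Real.sqrt μ * ‖P (proj x φ)‖ := by
    rw [← hket, map_smul, norm_smul, Complex.norm_real, Real.norm_of_nonneg hs.le]
  rw [hnorm, mul_pow, Real.sq_sqrt hμ.le]
  gcongr

end Walk

/-! ### Phase estimation as a query algorithm -/

/-- The isometry `J₁ s ↦ J₂ s` on the range of `J₁` extends to all of `H` by finite dimension. This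
supplies the gates of the query algorithm. -/
theorem exists_isometryEquiv_apply_eq {G H : Type*} [NormedAddCommGroup G] [InnerProductSpace ℂ G]
    [NormedAddCommGroup H] [InnerProductSpace ℂ H] [FiniteDimensional ℂ H]
    (J₁ J₂ : G →ₗᵢ[ℂ] H) : ∃ V : H ≃ₗᵢ[ℂ] H, ∀ s, V (J₁ s) = J₂ s := by
  let L : LinearMap.range J₁.toLinearMap →ₗᵢ[ℂ] H :=
    J₂.comp J₁.equivRange.symm.toLinearIsometry
  refine ⟨L.extend.toLinearIsometryEquiv rfl, fun s => ?_⟩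
  have h := L.extend_apply (J₁.equivRange s)
  have h2 : L (J₁.equivRange s) = J₂ s := by simp [L]
  exact h.trans h2

section Registers

variable {n m t K : ℕ}

/-- The joint Hilbert space of the system and of the registers. -/
abbrev JointSpace (n m t K : ℕ) : Type := PiLp 2 fun _ : Registers t K => Space n m

/-- The workspace labels: the part `ℂᵐ ⊗ ℂ²` of the system together with a flag for `|0̂⟩`, and the
registers. -/
abbrev Work (m t K : ℕ) : Type := Option (Fin m × Bool) × Registers t K

/-- The total contents of the registers. -/
def regSum (j : Registers t K) : ℕ := ∑ k, (j k : ℕ)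

theorem regSum_le (j : Registers t K) : regSum j ≤ K * (2 ^ t - 1) := by
  refine (Finset.sum_le_card_nsmul _ _ (2 ^ t - 1) fun k _ => Nat.le_sub_one_of_lt (j k).2).trans ?_
  simp

/-- The amplitude of the system vector `v` that is stored under the query label `i` and the
workspace label `w`; the vector `|0̂⟩` is stored under the query label `i₀`. -/
def storedAmp (i₀ : Fin n) (v : Space n m) (i : Fin n) : Option (Fin m × Bool) → ℂ
  | none => if i = i₀ then v (Sum.inl ()) else 0
  | some kb => v (Sum.inr (i, kb))

/-- The sign in the target qubit: it is `|-⟩` for the active labels and `|+⟩` for the others. -/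
def targetSign (a : ℕ) (j : Registers t K) (β : Bool) : Option (Fin m × Bool) → ℂ
  | none => 1
  | some _ => if β = true ∧ a ≤ regSum j then -1 else 1

theorem norm_targetSign (a : ℕ) (j : Registers t K) (β : Bool) (w : Option (Fin m × Bool)) :
    ‖targetSign a j β w‖ = 1 := by
  cases w
  · simp [targetSign]
  · simp only [targetSign]
    split_ifs <;> simp

theorem sum_norm_sq_storedAmp (i₀ : Fin n) (v : Space n m) :
    ∑ i, ∑ w, ‖storedAmp i₀ v i w‖ ^ 2 = ‖v‖ ^ 2 := by
  rw [EuclideanSpace.norm_sq_eq, Fintype.sum_sum_type, Fintype.sum_prod_type]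
  simp only [Fintype.sum_option, storedAmp, Finset.sum_add_distrib]
  congr 1
  rw [Finset.sum_eq_single i₀]
  · simp
  · intro i _ hi
    simp [hi]
  · simp

/-- The joint state `s` written into the query space, with active labels those whose registers
hold at least `a` in total. -/
def embedFun (i₀ : Fin n) (a : ℕ) (s : JointSpace n m t K) : QuerySpace n (Work m t K) :=
  WithLp.toLp 2 fun p =>
    ((1 / Real.sqrt 2 : ℝ) : ℂ) * targetSign a p.2.2.2 p.2.1 p.2.2.1
      * storedAmp i₀ (s p.2.2.2) p.1 p.2.2.1

theorem sum_norm_sq_embedFun (i₀ : Fin n) (a : ℕ) (s : JointSpace n m t K) (j : Registers t K) :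
    ∑ i, ∑ β, ∑ w, ‖embedFun i₀ a s (i, β, (w, j))‖ ^ 2 = ‖s j‖ ^ 2 := by
  have h : ∀ i β w, ‖embedFun i₀ a s (i, β, (w, j))‖ ^ 2
      = 1 / 2 * ‖storedAmp i₀ (s j) i w‖ ^ 2 := by
    intro i β w
    simp only [embedFun]
    rw [norm_mul, norm_mul, norm_targetSign, mul_one, Complex.norm_real, mul_pow, Real.norm_eq_abs,
      sq_abs, div_pow, Real.sq_sqrt (by norm_num), one_pow]
  simp_rw [h, ← Finset.mul_sum]
  rw [← sum_norm_sq_storedAmp i₀ (s j), Finset.mul_sum]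
  refine Finset.sum_congr rfl fun i _ => ?_
  rw [Fintype.sum_bool]
  ring

theorem sum_querySpace (g : Fin n × Bool × Work m t K → ℝ) :
    ∑ p, g p = ∑ j, ∑ i, ∑ β, ∑ w, g (i, β, (w, j)) := by
  simp only [Fintype.sum_prod_type]
  symm
  rw [Finset.sum_comm]
  refine Finset.sum_congr rfl fun i _ => ?_
  rw [Finset.sum_comm]
  exact Finset.sum_congr rfl fun β _ => Finset.sum_comm

/-- `embedFun` as a linear isometry. -/
def embed (i₀ : Fin n) (a : ℕ) : JointSpace n m t K →ₗᵢ[ℂ] QuerySpace n (Work m t K) where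
  toFun := embedFun i₀ a
  map_add' s s' := by
    ext ⟨i, β, w, j⟩
    cases w
    · by_cases h : i = i₀ <;> simp [embedFun, storedAmp, h, mul_add]
    · simp [embedFun, storedAmp, mul_add]
  map_smul' c s := by
    ext ⟨i, β, w, j⟩
    cases w
    · by_cases h : i = i₀ <;> simp [embedFun, storedAmp, h, mul_left_comm]
    · simp [embedFun, storedAmp, mul_left_comm]
  norm_map' s := by
    rw [← pow_left_inj₀ (norm_nonneg _) (norm_nonneg _) two_ne_zero]
    simp only [LinearMap.coe_mk, AddHom.coe_mk]
    rw [EuclideanSpace.norm_sq_eq, PiLp.norm_sq_eq_of_L2, sum_querySpace]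
    simp_rw [sum_norm_sq_embedFun]

theorem embed_apply (i₀ : Fin n) (a : ℕ) (s : JointSpace n m t K) :
    embed i₀ a s = embedFun i₀ a s := rfl

/-- `U_x` controlled on the registers holding at least `a` in total. -/
def ctrlWalk (R : Space n m →L[ℂ] Space n m) (x : Fin n → Bool) (a : ℕ)
    (s : JointSpace n m t K) : JointSpace n m t K :=
  WithLp.toLp 2 fun j => if a ≤ regSum j then walk R x (s j) else s j

/-- Phase kickback: on the target `|-⟩` the oracle multiplies by `(-1)^(x_i)`, which turns the
reflection for the zero input into the one for `x`. Inactive labels and `|0̂⟩` have target `|+⟩` and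
are unaffected. -/
theorem oracle_embed (i₀ : Fin n) (R : Space n m →L[ℂ] Space n m) (x : Fin n → Bool) (a : ℕ)
    (s : JointSpace n m t K) :
    oracle (Work m t K) x (embed i₀ a (ctrlWalk R (fun _ => false) a s))
      = embed i₀ a (ctrlWalk R x a s) := by
  ext ⟨i, β, w, j⟩
  have hO : ∀ v : QuerySpace n (Work m t K),
      oracle (Work m t K) x v (i, β, (w, j)) = v (i, xor β (x i), (w, j)) := fun v => rfl
  rw [hO, embed_apply, embed_apply]
  simp only [embedFun, ctrlWalk]
  by_cases ha : a ≤ regSum j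
  · simp only [if_pos ha]
    cases w with
    | none => simp [targetSign, storedAmp, walk_apply, reflSign]
    | some kb =>
      obtain ⟨k, b⟩ := kb
      simp only [targetSign, storedAmp, walk_apply, reflSign, ha, and_true]
      cases β <;> cases b <;> cases x i <;> simp
  · cases w <;> simp [targetSign, ha]

/-- `ctrlWalk` as a linear isometry. -/
def ctrlWalkIsometry {R : Space n m →L[ℂ] Space n m}
    (hR : R ∈ unitary (Space n m →L[ℂ] Space n m)) (x : Fin n → Bool) (a : ℕ) :
    JointSpace n m t K →ₗᵢ[ℂ] JointSpace n m t K where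
  toFun := ctrlWalk R x a
  map_add' s s' := by
    ext j : 2
    by_cases h : a ≤ regSum j <;> simp [ctrlWalk, h]
  map_smul' c s := by
    ext j : 2
    by_cases h : a ≤ regSum j <;> simp [ctrlWalk, h]
  norm_map' s := by
    rw [← pow_left_inj₀ (norm_nonneg _) (norm_nonneg _) two_ne_zero]
    simp only [LinearMap.coe_mk, AddHom.coe_mk]
    rw [PiLp.norm_sq_eq_of_L2, PiLp.norm_sq_eq_of_L2]
    refine Finset.sum_congr rfl fun j _ => ?_
    by_cases h : a ≤ regSum j <;> simp [ctrlWalk, h, norm_walk hR]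

theorem sum_norm_sq_inverseFourier {E : Type*} [NormedAddCommGroup E] [InnerProductSpace ℂ E]
    (s : Registers t K → E) : ∑ y, ‖inverseFourier t K s y‖ ^ 2 = ∑ j, ‖s j‖ ^ 2 := by
  refine sum_norm_sq_sum_smul (fun j y : Registers t K => ∏ k, fourierKernel t (j k) (y k))
    (fun j j' => ?_) s
  simp_rw [map_prod, ← Finset.prod_mul_distrib]
  have h := Finset.prod_univ_sum (fun _ : Fin K => (Finset.univ : Finset (Fin (2 ^ t))))
    (fun k y => (starRingEnd ℂ) (fourierKernel t (j k) y) * fourierKernel t (j' k) y)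
  rw [Fintype.piFinset_univ] at h
  rw [← h]
  simp_rw [sum_conj_fourierKernel_mul]
  split_ifs with hj
  · subst hj; simp
  · obtain ⟨k, hk⟩ := Function.ne_iff.1 hj
    exact Finset.prod_eq_zero (Finset.mem_univ k) (if_neg hk)

/-- The inverse Fourier transform as a linear isometry. -/
def fourierIsometry (n m t K : ℕ) : JointSpace n m t K →ₗᵢ[ℂ] JointSpace n m t K where
  toFun s := WithLp.toLp 2 (inverseFourier t K s)
  map_add' s s' := by
    ext j : 2
    simp [inverseFourier, Finset.sum_add_distrib]
  map_smul' c s := by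
    ext j : 2
    simp [inverseFourier, Finset.smul_sum, smul_comm c]
  norm_map' s := by
    rw [← pow_left_inj₀ (norm_nonneg _) (norm_nonneg _) two_ne_zero]
    simp only [LinearMap.coe_mk, AddHom.coe_mk]
    rw [PiLp.norm_sq_eq_of_L2, PiLp.norm_sq_eq_of_L2]
    exact sum_norm_sq_inverseFourier _

/-- The joint state after `a` controlled applications of `U_x`. -/
def partialState (t K : ℕ) (R : Space n m →L[ℂ] Space n m) (x : Fin n → Bool) (a : ℕ) :
    JointSpace n m t K :=
  WithLp.toLp 2 fun j =>
    (walk R x ^ min a (regSum j)) (uniformRegisters t K (ket0 n m) j)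

theorem partialState_zero (R : Space n m →L[ℂ] Space n m) (x : Fin n → Bool) :
    partialState t K R x 0 = WithLp.toLp 2 (uniformRegisters t K (ket0 n m)) := by
  simp [partialState]

/-- Step `a + 1` acts exactly on the registers whose total is not yet exhausted. -/
theorem partialState_succ (R : Space n m →L[ℂ] Space n m) (x : Fin n → Bool) (a : ℕ) :
    partialState t K R x (a + 1) = ctrlWalk R x (a + 1) (partialState t K R x a) := by
  ext j : 2
  by_cases h : a + 1 ≤ regSum j
  · simp only [partialState, ctrlWalk, if_pos h]
    rw [min_eq_left h, min_eq_left (by omega), pow_succ', mul_apply_eq_comp]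
  · simp only [partialState, ctrlWalk, if_neg h]
    rw [min_eq_right (by omega), min_eq_right (by omega)]

theorem fourierIsometry_partialState (R : Space n m →L[ℂ] Space n m) (x : Fin n → Bool)
    (y : Registers t K) :
    fourierIsometry n m t K (partialState t K R x (K * (2 ^ t - 1))) y
      = phaseEstimationState t K (walk R x) (ket0 n m) y := by
  have h : (partialState t K R x (K * (2 ^ t - 1))).ofLp
      = controlledPowers t K (walk R x) (uniformRegisters t K (ket0 n m)) := by
    funext j
    simp only [partialState, controlledPowers]
    rw [min_eq_right (regSum_le j)]
    rfl
  change inverseFourier t K (partialState t K R x (K * (2 ^ t - 1))).ofLp y = _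
  rw [h, phaseEstimationState]

theorem norm_uniformRegisters :
    ‖(WithLp.toLp 2 (uniformRegisters t K (ket0 n m)) : JointSpace n m t K)‖ = 1 := by
  rw [← pow_left_inj₀ (norm_nonneg _) zero_le_one two_ne_zero, PiLp.norm_sq_eq_of_L2]
  simp only [uniformRegisters, norm_smul, norm_ket0, mul_one, Complex.norm_real, Real.norm_eq_abs,
    sq_abs, Finset.prod_const, Finset.card_univ, Fintype.card_fin, Finset.sum_const, nsmul_eq_mul,
    Fintype.card_pi, one_pow]
  have h : ((1 / Real.sqrt (2 ^ t)) ^ K) ^ 2 = (1 / 2 ^ t) ^ K := by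
    rw [← pow_mul, mul_comm K 2, pow_mul, div_pow, Real.sq_sqrt (by positivity), one_pow]
  rw [h]
  push_cast
  rw [← mul_pow]
  simp

/-- Phase estimation on `U_x` with `K` registers of `t` qubits takes `K (2 ^ t - 1)` queries. -/
theorem exists_queryAlgorithm (t K : ℕ) (θ : ℝ) (hn : 0 < n)
    {R : Space n m →L[ℂ] Space n m} (hR : R ∈ unitary (Space n m →L[ℂ] Space n m)) :
    ∃ A : QueryAlgorithm n (Work m t K), A.queries = K * (2 ^ t - 1) ∧
      ∀ x, A.probAccept x = probPhaseZero t K θ (walk R x) (ket0 n m) := by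
  classical
  set T := K * (2 ^ t - 1) with hT
  let i₀ : Fin n := ⟨0, hn⟩
  -- Each gate before the last also performs the input-independent half of the next controlled step,
  -- which the following query completes. After the last query comes the Fourier transform; the
  -- target signs no longer matter, as only norms are measured.
  let post : ℕ → (JointSpace n m t K →ₗᵢ[ℂ] QuerySpace n (Work m t K)) := fun a =>
    if a < T then (embed i₀ (a + 1)).comp (ctrlWalkIsometry hR (fun _ => false) (a + 1))
    else (embed i₀ 0).comp (fourierIsometry n m t K)
  let p₀ : Fin n × Bool × Work m t K := (i₀, false, (none, fun _ => 0))
  let s₀ : JointSpace n m t K := WithLp.toLp 2 (uniformRegisters t K (ket0 n m))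
  obtain ⟨V₀, hV₀⟩ := exists_isometryEquiv_apply_eq
    (LinearIsometry.toSpanSingleton ℂ (QuerySpace n (Work m t K))
      (v := EuclideanSpace.single p₀ 1) (by simp))
    (LinearIsometry.toSpanSingleton ℂ (QuerySpace n (Work m t K)) (v := post 0 s₀)
      (by rw [LinearIsometry.norm_map]; exact norm_uniformRegisters))
  choose V hV using fun a => exists_isometryEquiv_apply_eq (embed (m := m) (t := t) (K := K) i₀ a)
    (post a)
  let A : QueryAlgorithm n (Work m t K) :=
    { queries := T
      gate := fun a => if a = 0 then V₀ else V a
      init := p₀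
      accept := Finset.univ.filter fun p => IsPhaseZero t K θ p.2.2.2 }
  refine ⟨A, rfl, fun x => ?_⟩
  have hstate : ∀ a, a ≤ T → A.state x a = post a (partialState t K R x a) := by
    intro a
    induction a with
    | zero =>
      intro _
      have := hV₀ 1
      simp only [LinearIsometry.toSpanSingleton_apply, one_smul] at this
      rw [partialState_zero]
      exact this
    | succ a ih =>
      intro ha
      have h1 : A.state x (a + 1) = V (a + 1) (oracle (Work m t K) x (A.state x a)) := rfl
      have h2 : post a (partialState t K R x a)
          = embed i₀ (a + 1) (ctrlWalk R (fun _ => false) (a + 1) (partialState t K R x a)) := by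
        simp only [post]
        rw [if_pos (by omega)]
        rfl
      rw [h1, ih (by omega), h2, oracle_embed, ← partialState_succ, hV]
  have hfinal : A.state x A.queries
      = embedFun i₀ 0 (fourierIsometry n m t K (partialState t K R x T)) := by
    change A.state x T = _
    rw [hstate T le_rfl]
    simp only [post]
    rw [if_neg (lt_irrefl T)]
    rfl
  rw [QueryAlgorithm.probAccept, hfinal]
  simp only [A]
  rw [Finset.sum_filter, sum_querySpace, probPhaseZero, Finset.sum_filter]
  refine Finset.sum_congr rfl fun y _ => ?_
  simp only
  by_cases hy : IsPhaseZero t K θ y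
  · simp only [if_pos hy]
    rw [sum_norm_sq_embedFun, fourierIsometry_partialState]
  · simp [hy]

end Registers

/-! ### Choice of the parameters -/

theorem half_le_log_two : 1 / 2 ≤ Real.log 2 := by
  linarith [Real.log_two_gt_d9]

theorem exists_register_size {θ : ℝ} (hθ : 0 < θ) (hθ1 : θ ≤ 1) :
    ∃ t : ℕ, 512 / θ ≤ 2 ^ t ∧ (2 : ℝ) ^ t ≤ 1024 / θ ∧ (t : ℝ) ≤ 20 * Real.log (2 / θ) := by
  have h1 : (1 : ℝ) ≤ 512 / θ := by rw [le_div_iff₀ hθ]; linarith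
  obtain ⟨k, hk1, hk2⟩ := exists_nat_pow_near h1 (one_lt_two : (1 : ℝ) < 2)
  have hle : (2 : ℝ) ^ (k + 1) ≤ 1024 / θ := by
    rw [pow_succ, show 1024 / θ = 512 / θ * 2 by ring]
    gcongr
  refine ⟨k + 1, hk2.le, hle, ?_⟩
  have h2 := Real.log_le_log (by positivity) hle
  -- With `log 2 ≤ log (2 / θ)` this gives `t log 2 ≤ 10 log (2 / θ)`, and `log 2 ≥ 1 / 2` yields
  -- 20.
  have h3 : Real.log (1024 / θ) = 9 * Real.log 2 + Real.log (2 / θ) := by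
    rw [show 1024 / θ = 2 ^ 9 * (2 / θ) by ring, Real.log_mul (by positivity) (by positivity),
      Real.log_pow]
    norm_num
  have h4 : Real.log 2 ≤ Real.log (2 / θ) := by
    apply Real.log_le_log (by norm_num)
    rw [le_div_iff₀ hθ]; linarith
  rw [Real.log_pow, h3] at h2
  have h5 := half_le_log_two
  have h6 : (0 : ℝ) ≤ ((k + 1 : ℕ) : ℝ) := by positivity
  nlinarith

theorem exists_register_count {δ : ℝ} (hδ : 0 < δ) (hδ2 : δ < 1 / 2) :
    ∃ K : ℕ, (1 / 2) ^ K ≤ δ ∧ (K : ℝ) ≤ 4 * Real.log (1 / δ) := by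
  have h1 : (1 : ℝ) ≤ 1 / δ := by rw [le_div_iff₀ hδ]; linarith
  obtain ⟨k, hk1, hk2⟩ := exists_nat_pow_near h1 (one_lt_two : (1 : ℝ) < 2)
  refine ⟨k + 1, ?_, ?_⟩
  · rw [one_div_pow, one_div_le (by positivity) hδ]
    exact hk2.le
  have h2 := Real.log_le_log (by positivity) hk1
  -- This absorbs the `+ 1` in `K = k + 1`, and is where `δ < 1 / 2` is needed.
  have h4 : Real.log 2 ≤ Real.log (1 / δ) := by
    apply Real.log_le_log (by norm_num)
    rw [le_div_iff₀ hδ]; linarith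
  rw [Real.log_pow] at h2
  have h5 := half_le_log_two
  push_cast
  have h6 : (0 : ℝ) ≤ (k : ℝ) := by positivity
  nlinarith

theorem logb_two_le {a : ℝ} {s : ℕ} {b : ℝ} (ha : 0 < a) (h : a ≤ b ^ s) (hb : 1 ≤ b) :
    Real.logb 2 a ≤ 2 * s * Real.log b := by
  have h1 := Real.log_le_log ha h
  rw [Real.log_pow] at h1
  have h2 := half_le_log_two
  have h3 : 0 ≤ (s : ℝ) * Real.log b := mul_nonneg (by positivity) (Real.log_nonneg hb)
  rw [Real.logb, div_le_iff₀ (by linarith)]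
  nlinarith

theorem logb_card_idx_le {n m : ℕ} (hn : 0 < n) (hm : 0 < m) :
    Real.logb 2 (Fintype.card (Idx n m)) ≤ 4 * Real.log (n * m + 1) := by
  have h1 : (1 : ℝ) ≤ (n : ℝ) * m := by exact_mod_cast Nat.mul_pos hn hm
  have hcard : (Fintype.card (Idx n m) : ℝ) = 1 + n * (m * 2) := by simp
  have h := logb_two_le (a := Fintype.card (Idx n m)) (s := 2) (b := (n : ℝ) * m + 1)
    (by rw [hcard]; positivity) (by rw [hcard]; nlinarith) (by linarith)
  norm_num at h ⊢
  exact h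

theorem qubits_le {n m t K : ℕ} (hn : 0 < n) (hm : 0 < m) (A : QueryAlgorithm n (Work m t K)) :
    A.qubits ≤ 6 * Real.log (n * m + 1) + t * K := by
  have hm1 : (1 : ℝ) ≤ m := by exact_mod_cast hm
  have hn1 : (1 : ℝ) ≤ n := by exact_mod_cast hn
  have h1 : (1 : ℝ) ≤ (n : ℝ) * m := by exact_mod_cast Nat.mul_pos hn hm
  have hcard : (Fintype.card (Fin n × Bool × Work m t K) : ℝ)
      = (n * (2 * (m * 2 + 1))) * 2 ^ (t * K) := by
    simp [pow_mul]
    ring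
  have hpos : (0 : ℝ) < n * (2 * (m * 2 + 1)) := by positivity
  have h := logb_two_le (a := n * (2 * (m * 2 + 1))) (s := 3) (b := (n : ℝ) * m + 1) hpos
    (by
      have h2 : (n : ℝ) * (2 * (m * 2 + 1)) ≤ 6 * (n * m) := by nlinarith
      nlinarith [mul_nonneg (sub_nonneg.2 h1) (sub_nonneg.2 h1), pow_pos (by linarith : (0 : ℝ) < n * m) 3])
    (by linarith)
  unfold QueryAlgorithm.qubits
  rw [hcard, Real.logb_mul hpos.ne' (by positivity), Real.logb_pow, Real.logb_self_eq_one (by norm_num)]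
  push_cast at h ⊢
  linarith

/-- The parameters of phase estimation. When `δ ≥ 1 / 2` no register is used: the query bound
`O(1 / θ * log (1 / δ))` tends to `0` as `δ` tends to `1`. -/
theorem exists_parameters {θ δ : ℝ} (hθ : 0 < θ) (hθ1 : θ ≤ 1) (hδ : 0 < δ) (hδ1 : δ ≤ 1) :
    ∃ t K : ℕ, ((512 / θ ≤ 2 ^ t ∧ (1 / 2) ^ K ≤ δ) ∨ (K = 0 ∧ 1 / 2 ≤ δ)) ∧
      ((K * (2 ^ t - 1) : ℕ) : ℝ) ≤ 4096 * (1 / θ * Real.log (1 / δ)) ∧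
      (t : ℝ) * K ≤ 80 * (Real.log (2 / θ) * Real.log (1 / δ)) := by
  have hL : 0 ≤ Real.log (1 / δ) := Real.log_nonneg (by rw [le_div_iff₀ hδ]; linarith)
  have hT : 0 ≤ Real.log (2 / θ) := Real.log_nonneg (by rw [le_div_iff₀ hθ]; linarith)
  rcases lt_or_ge δ (1 / 2) with h | h
  · obtain ⟨t, ht1, ht2, ht3⟩ := exists_register_size hθ hθ1
    obtain ⟨K, hK1, hK2⟩ := exists_register_count hδ h
    refine ⟨t, K, Or.inl ⟨ht1, hK1⟩, ?_, ?_⟩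
    · have h1 : ((K * (2 ^ t - 1) : ℕ) : ℝ) ≤ (K : ℝ) * 2 ^ t := by
        exact_mod_cast Nat.mul_le_mul_left K (Nat.sub_le (2 ^ t) 1)
      calc ((K * (2 ^ t - 1) : ℕ) : ℝ) ≤ (K : ℝ) * 2 ^ t := h1
        _ ≤ (4 * Real.log (1 / δ)) * (1024 / θ) := by gcongr
        _ = 4096 * (1 / θ * Real.log (1 / δ)) := by ring
    · calc (t : ℝ) * K ≤ (20 * Real.log (2 / θ)) * (4 * Real.log (1 / δ)) := by gcongr
        _ = 80 * (Real.log (2 / θ) * Real.log (1 / δ)) := by ring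
  · refine ⟨0, 0, Or.inr ⟨rfl, h⟩, ?_, ?_⟩
    · rw [Nat.zero_mul, Nat.cast_zero]
      positivity
    · rw [Nat.cast_zero, zero_mul]
      positivity

theorem probPhaseZero_zero_registers {E : Type*} [NormedAddCommGroup E] [InnerProductSpace ℂ E]
    (t : ℕ) (θ : ℝ) (U : E →L[ℂ] E) (v : E) : probPhaseZero t 0 θ U v = 0 := by
  classical
  unfold probPhaseZero
  rw [Finset.filter_false_of_mem, Finset.sum_empty]
  intro y _
  simp [isPhaseZero_iff]

end DualAdversary

open DualAdversary in
theorem mainTheorem1 :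
    ∃ C : ℝ, 0 < C ∧
    -- the precision and the error fix the phase estimation circuit
    ∀ θ δ : ℝ, 0 < θ → θ ≤ 1 → 0 < δ → δ ≤ 1 → ∃ t K : ℕ,
    ∀ (n m : ℕ), 0 < n → 0 < m →
    ∀ R : DualAdversary.Space n m →L[ℂ] DualAdversary.Space n m,
      R ∈ unitary (DualAdversary.Space n m →L[ℂ] DualAdversary.Space n m) →
    -- the size of the system on which the unitary acts
    Real.logb 2 (Fintype.card (DualAdversary.Idx n m)) ≤ C * Real.log (n * m + 1) ∧
    -- phase estimation is a query algorithm with the claimed numbers of queries and qubits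
    (∃ (W : Type) (_ : Fintype W) (_ : DecidableEq W) (A : DualAdversary.QueryAlgorithm n W),
      (A.queries : ℝ) ≤ C * (1 / θ * Real.log (1 / δ)) ∧
      A.qubits ≤ C * (Real.log (n * m + 1) + Real.log (2 / θ) * Real.log (1 / δ)) ∧
      ∀ x : Fin n → Bool, A.probAccept x =
        DualAdversary.probPhaseZero t K θ (DualAdversary.walk R x) (DualAdversary.ket0 n m)) ∧
    -- the probability of the outcome "phase 0"
    ∀ (X : Set (Fin n → Bool)) (f : X → Bool) (ν μ : X → ℝ) (εψ εφ : ℝ)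
      (η ψ φ : X → DualAdversary.Space n m),
      (∀ x, 0 < ν x) → (∀ x, 0 < μ x) → 0 ≤ εψ → 0 ≤ εφ →
      (∀ x, inner ℂ (η x) (DualAdversary.ket0 n m) = 0) →
      (∀ x, f x = true →
        ψ x = ((1 / Real.sqrt (ν x) : ℝ) : ℂ) • (DualAdversary.ket0 n m + η x)) →
      (∀ x, f x = false →
        φ x = ((1 / Real.sqrt (μ x) : ℝ) : ℂ) • (DualAdversary.ket0 n m + η x)) →
      (∀ x, f x = true → ‖ψ x - DualAdversary.walk R x (ψ x)‖ ≤ εψ) →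
      (∀ x, f x = false → DualAdversary.proj x.1 (η x) = 0 ∧ ‖φ x + R (φ x)‖ ≤ εφ) →
      (∀ x, f x = true →
        max 0 (Real.sqrt (ν x * (‖ψ x‖ ^ 2 - 5 * εψ ^ 2 / θ ^ 2))
            - Real.sqrt (ν x * ‖ψ x‖ ^ 2 - 1)) ^ 2 * (1 - δ) - δ
          ≤ DualAdversary.probPhaseZero t K θ (DualAdversary.walk R x) (DualAdversary.ket0 n m)) ∧
      (∀ x, f x = true → 1 ≤ ‖ψ x‖ →
        max 0 (Real.sqrt (ν x * (1 - 5 * εψ ^ 2 / θ ^ 2))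
            - Real.sqrt (ν x * ‖ψ x‖ ^ 2 - 1)) ^ 2 * (1 - δ) - δ
          ≤ DualAdversary.probPhaseZero t K θ (DualAdversary.walk R x) (DualAdversary.ket0 n m)) ∧
      (∀ x, f x = false →
        DualAdversary.probPhaseZero t K θ (DualAdversary.walk R x) (DualAdversary.ket0 n m)
          ≤ μ x * (εφ / 2 + θ / 2 * ‖φ x‖) ^ 2 + δ) := by
  refine ⟨5000, by norm_num, fun θ δ hθ hθ1 hδ hδ1 => ?_⟩
  obtain ⟨t, K, hpar, hqueries, hqubits⟩ := exists_parameters hθ hθ1 hδ hδ1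
  have hL : 0 ≤ Real.log (1 / δ) := Real.log_nonneg (by rw [le_div_iff₀ hδ]; linarith)
  have hT : 0 ≤ Real.log (2 / θ) := Real.log_nonneg (by rw [le_div_iff₀ hθ]; linarith)
  have hQ : 0 ≤ 1 / θ * Real.log (1 / δ) := by positivity
  have hTL := mul_nonneg hT hL
  refine ⟨t, K, fun n m hn hm R hR => ?_⟩
  have hnm : 0 ≤ Real.log ((n : ℝ) * m + 1) := Real.log_nonneg (by
    have : (0 : ℝ) ≤ (n : ℝ) * m := by positivity
    linarith)
  refine ⟨(logb_card_idx_le hn hm).trans (by linarith), ?_, ?_⟩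
  · obtain ⟨A, hA, hprob⟩ := exists_queryAlgorithm (m := m) t K θ hn hR
    refine ⟨Work m t K, inferInstance, inferInstance, A, ?_, ?_, hprob⟩
    · rw [hA]
      linarith
    · linarith [qubits_le hn hm A]
  intro X f ν μ εψ εφ η ψ φ hν hμ _ _ horth hψ hφ hψε hφε
  have hδ0 : 0 ≤ 1 - δ := by linarith
  have hlower : ∀ x, f x = true →
      max 0 (Real.sqrt (ν x * (‖ψ x‖ ^ 2 - 5 * εψ ^ 2 / θ ^ 2))
          - Real.sqrt (ν x * ‖ψ x‖ ^ 2 - 1)) ^ 2 * (1 - δ) - δ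
        ≤ probPhaseZero t K θ (walk R x) (ket0 n m) := by
    intro x hx
    obtain ⟨N, b, ω, hω, hb⟩ := exists_walk_eigenbasis hR x.1
    have h1 := overlap_sq_le_spectralCut hb hω hθ hθ1 (hν x) norm_ket0 (horth x) (hψ x hx)
      (hψε x hx)
    have h2 := mul_le_mul_of_nonneg_right h1 hδ0
    rcases hpar with ⟨ht, hK⟩ | ⟨rfl, hδ2⟩
    · linarith [spectralCut_le_probPhaseZero hb hω hθ ht hK (ket0 n m)]
    -- Without registers a strict majority is impossible. The overlap is at most 1, so the claimed
    -- lower bound is at most `1 - 2δ ≤ 0`.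
    · rw [probPhaseZero_zero_registers]
      have h3 : ‖spectralCut b {a | |ω a| ≤ θ / 2} (ket0 n m)‖ ^ 2 ≤ 1 :=
        pow_le_one₀ (norm_nonneg _) ((norm_spectralCut_le _ _ _).trans norm_ket0.le)
      linarith [mul_le_of_le_one_left hδ0 h3]
  refine ⟨hlower, fun x hx hnorm => le_trans ?_ (hlower x hx), fun x hx => ?_⟩
  · have hνx := (hν x).le
    have hsq : 1 ≤ ‖ψ x‖ ^ 2 := one_le_pow₀ hnorm
    gcongr
  · obtain ⟨N, b, ω, hω, hb⟩ := exists_walk_eigenbasis hR x.1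
    have h1 := norm_sq_spectralCut_ket0_le hb hθ (hμ x) (hφ x hx) (hφε x hx).1 (hφε x hx).2
    rcases hpar with ⟨ht, hK⟩ | ⟨rfl, hδ2⟩
    · linarith [probPhaseZero_le_spectralCut hb hω hθ ht hK (ket0 n m) norm_ket0]
    · rw [probPhaseZero_zero_registers]
      have := mul_nonneg (hμ x).le (sq_nonneg (εφ / 2 + θ / 2 * ‖φ x‖))
      linarith

end
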